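/- **Setting.** Fix a many-sorted first-order theory, given by a signature with a Boolean sort and a structure interpreting it. An *assertion* over a set of variables is a first-order formula over that signature with free variables among them; it may also contain *uninterpreted predicates*, i.e. predicate symbols, each with a fixed arity, whose meaning is given by an *interpretation* $\mathcal I$ that assigns an arbitrary relation to each symbol (first-order expressible or not). A *program* (fair transition system) is $D=(v,init(v),next(v,v'),J)$, where $v$ is a set of variables, $init$ and $next$ are assertions, and $J$ is a finite set of assertions over $v$ (the fairness conditions). A state is a valuation of $v$; a path is an infinite sequence of states, any two consecutive ones of which satisfy $next$; it is fair if every member of $J$ holds infinitely often along it. $CTL^*$ formulas are in negation normal form: state formulas are built from assertions by $\wedge,\vee$ and $A\pi,E\pi,A_f\pi,E_f\pi$ ($A,E$ range over all paths from the state, $A_f,E_f$ over the fair ones), and path formulas $\pi$ from state formulas by $\wedge,\vee,X,G,U$. $D\models\phi$ means that $\phi$ holds in every state satisfying $init$. A *basic* state formula is $Q\pi$ with $Q\in\{A,E,A_f,E_f\}$ and $\pi$ without path quantifiers. An *existential Horn clause* is either $\forall x\,(\alpha(x)\to\exists y\,\beta(x,y))$ with assertions $\alpha,\beta$, or $dwf(r)$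 for an uninterpreted $r$ of arity $2|v|$; the latter holds if $r$ is disjunctively well-founded, i.e. a finite union of relations none of which has an infinite chain $s_0\,w\,s_1\,w\,s_2\cdots$. The sets $Clauses(D,\phi)$ that Trans produces are those obtained by finitely many applications, in any order, of the following rules, in which $c,c_1,c_2$ are assertions and all newly introduced predicate symbols and Boolean variables are fresh. 1. If $\phi_1$ is a basic state formula occurring in $\phi_2$: $Clauses(D,\phi_2(\phi_1))=Clauses((v,aux(v),next,J),\phi_1)\cup Clauses(D,\phi_2(aux(v)))$, where all occurrences of $\phi_1$ are replaced by $aux(v)$. 2. For basic $Q\pi$, $Q\in\{A,E\}$: $Clauses(D,Q\pi)=Clauses((v,init,next,\emptyset),Q_f\pi)$. 3. – 5. For a basic $Q_f\pi(\theta)$ in which $\theta$ is $Xc$, $Gc$ or $c_1Uc_2$, introduce a Boolean variable $x$, conjoin to $next$, respectively, $x=c(v')$, $\;x=(c(v)\wedge x')$, or $x=(c_2(v)\vee(c_1(v)\wedge x'))$, add to $J$, respectively, nothing, $\;x\vee\neg c(v)$, or $\neg x\vee c_2(v)$, and replace every occurrence of $\theta$ by $x$. For $A_f$ the initial condition stays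 $init(v)$; for $E_f$ it becomes $aux(v,x)$ with a fresh $aux$, and the clause $init(v)\to\exists x\,aux(v,x)$ is added. 6. $Clauses(D,A_fc)$ consists of $init(v)\wedge\neg c(v)\to p(v)$; $\;next(v,v')\wedge p(v)\to p(v')$; $\;dwf(r)$; $\;next(v,v')\to t(v,v')$; $\;t(v,v')\wedge next(v',v'')\to t(v,v'')$; and, for an enumeration $J=\{J_1,\dots,J_k\}$, of $p(v_0)\wedge\bigwedge_{i=1}^{k}(t(v_{i-1},v_i)\wedge J_i(v_i))\to r(v_0,v_k)$ if $k\ge1$, or of $p(v)\wedge t(v,v')\to r(v,v')$ if $J=\emptyset$. 7. For an enumeration $J=\{J_1,\dots,J_k\}$ with $k\ge1$, $Clauses(D,E_fc)$ consists of $init(v)\to c(v)\wedge q_1(v)$ and, for $1\le i\le k$, of $q_i(v)\to\exists v'\,\bigl(next(v,v')\wedge((J_i(v)\wedge q_{(i\bmod k)+1}(v'))\vee(r_i(v,v')\wedge q_i(v')))\bigr)$, $\;dwf(r_i)$ and $r_i(v,v')\wedge r_i(v',v'')\to r_i(v,v'')$. If $J=\emptyset$, it consists of $init(v)\to c(v)\wedge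 q(v)$ and $q(v)\to\exists v'\,(next(v,v')\wedge q(v'))$. 8. $Clauses(D,c)=\{init(v)\to c(v)\}$. **Theorem (relative completeness).** If $D\models\phi$, then every set of clauses produced by Trans for $Clauses(D,\phi)$ is satisfied by some interpretation of the uninterpreted predicates. (If $D$ or $\phi$ themselves contain uninterpreted predicates and $D\models\phi$ holds under an interpretation $\mathcal I_0$ of them, then the satisfying interpretation can be chosen to agree with $\mathcal I_0$ on all symbols except the fresh ones.) -/

import Mathlib

namespace CTLStar

/-! ### Many-sorted first-order assertions with uninterpreted predicates -/

/-- The sorts: the Boolean sort and the data sorts of the background theory. -/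
inductive Ty (S : Type) : Type
  | bool : Ty S
  | data (s : S) : Ty S

/-- The signature of the background theory. -/
structure Signature where
  Srt : Type
  Fn : List (Ty Srt) → Ty Srt → Type
  Rl : List (Ty Srt) → Type

/-- A sorted set of variables: `X t` is the set of variables of sort `t`. -/
abbrev Vars (S : Signature) : Type 1 := Ty S.Srt → Type

/-- Disjoint union of two sets of variables. -/
abbrev Vars.sum {S : Signature} (A B : Vars S) : Vars S := fun t => A t ⊕ B t

/-- `k` disjoint copies of a set of variables. -/
abbrev Vars.copies {S : Signature} (k : ℕ) (A : Vars S) : Vars S := fun t => Fin k × A t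

/-- The empty set of variables. -/
abbrev Vars.none {S : Signature} : Vars S := fun _ => Empty

/-- A single variable, of sort `t`. -/
inductive Single {S : Signature} (t : Ty S.Srt) : Vars S
  | mk : Single t t

/-- `X` together with one new variable of sort `t`. -/
abbrev Vars.ext {S : Signature} (X : Vars S) (t : Ty S.Srt) : Vars S := Vars.sum X (Single t)

/-- Uninterpreted predicate symbols: a name, and an arity (one argument place of sort `t` for
each element of `arity t`). A symbol of arity `|v|` has arity `V`, one of arity `2|v|`
has arity `V.sum V`. -/
structure PredSym (S : Signature) : Type 1 where
  name : ℕ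
  arity : Vars S

/-- Terms over the variables `X`. -/
inductive Tm (S : Signature) (X : Vars S) : Ty S.Srt → Type
  | var {t : Ty S.Srt} (x : X t) : Tm S X t
  | app {l : List (Ty S.Srt)} {t : Ty S.Srt} (f : S.Fn l t)
      (args : (i : Fin l.length) → Tm S X (l.get i)) : Tm S X t

/-- Assertions: first-order formulas of the background theory with free variables in `X`,
in which uninterpreted predicates may occur. -/
inductive Fml (S : Signature) : Vars S → Type 1
  | tru {X : Vars S} : Fml S X
  | eq {X : Vars S} {t : Ty S.Srt} (a b : Tm S X t) : Fml S X
  | rel {X : Vars S} {l : List (Ty S.Srt)} (R : S.Rl l)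
      (args : (i : Fin l.length) → Tm S X (l.get i)) : Fml S X
  | holds {X : Vars S} (b : Tm S X Ty.bool) : Fml S X
  | pred {X : Vars S} (p : PredSym S) (args : (t : Ty S.Srt) → p.arity t → Tm S X t) : Fml S X
  | neg {X : Vars S} (a : Fml S X) : Fml S X
  | and {X : Vars S} (a b : Fml S X) : Fml S X
  | or {X : Vars S} (a b : Fml S X) : Fml S X
  | all {X : Vars S} (t : Ty S.Srt) (a : Fml S (X.ext t)) : Fml S X
  | ex {X : Vars S} (t : Ty S.Srt) (a : Fml S (X.ext t)) : Fml S X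

/-- Sort-preserving maps between sets of variables. -/
abbrev Ren {S : Signature} (X Y : Vars S) : Type := (t : Ty S.Srt) → X t → Y t

def Tm.rename {S : Signature} {X Y : Vars S} (f : Ren X Y) : {t : Ty S.Srt} → Tm S X t → Tm S Y t
  | _, .var x => .var (f _ x)
  | _, .app g args => .app g (fun i => (args i).rename f)

/-- Renaming of the free variables. -/
def Fml.rename {S : Signature} : {X Y : Vars S} → Ren X Y → Fml S X → Fml S Y
  | _, _, _, .tru => .tru
  | _, _, f, .eq a b => .eq (a.rename f) (b.rename f)
  | _, _, f, .rel R args => .rel R (fun i => (args i).rename f)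
  | _, _, f, .holds b => .holds (b.rename f)
  | _, _, f, .pred p args => .pred p (fun t x => (args t x).rename f)
  | _, _, f, .neg a => .neg (a.rename f)
  | _, _, f, .and a b => .and (a.rename f) (b.rename f)
  | _, _, f, .or a b => .or (a.rename f) (b.rename f)
  | _, _, f, .all t a => .all t (a.rename (fun u => Sum.map (f u) id))
  | _, _, f, .ex t a => .ex t (a.rename (fun u => Sum.map (f u) id))

/-- The uninterpreted predicate symbols that occur in an assertion. -/
def Fml.preds {S : Signature} : {X : Vars S} → Fml S X → Set (PredSym S)
  | _, .tru => ∅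
  | _, .eq _ _ => ∅
  | _, .rel _ _ => ∅
  | _, .holds _ => ∅
  | _, .pred p _ => {p}
  | _, .neg a => a.preds
  | _, .and a b => a.preds ∪ b.preds
  | _, .or a b => a.preds ∪ b.preds
  | _, .all _ a => a.preds
  | _, .ex _ a => a.preds

/-- The predicate symbol `p` applied to the variables given by `f`. -/
def Fml.papp {S : Signature} {X : Vars S} (p : PredSym S) (f : Ren p.arity X) : Fml S X :=
  .pred p (fun t x => .var (f t x))

/-- Equivalence, that is, equality of truth values. -/
def Fml.iff {S : Signature} {X : Vars S} (a b : Fml S X) : Fml S X :=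
  .or (.and a b) (.and (.neg a) (.neg b))

/-- Finite conjunction. -/
def Fml.conj {S : Signature} {X : Vars S} : List (Fml S X) → Fml S X
  | [] => .tru
  | a :: l => .and a (Fml.conj l)

/-! ### Semantics of assertions -/

/-- A structure interpreting the signature (the intended model of the background theory). -/
structure Model (S : Signature) where
  Dom : S.Srt → Type

/-- The domain of a sort. -/
def Model.den {S : Signature} (M : Model S) : Ty S.Srt → Type
  | .bool => Bool
  | .data s => M.Dom s

/-- A model together with the meaning of the function and relation symbols. -/
structure Struc (S : Signature) extends Model S where
  fn : {l : List (Ty S.Srt)} → {t : Ty S.Srt} → S.Fn l t →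
    ((i : Fin l.length) → toModel.den (l.get i)) → toModel.den t
  rl : {l : List (Ty S.Srt)} → S.Rl l → ((i : Fin l.length) → toModel.den (l.get i)) → Prop

/-- Valuations of the variables `X`. For the set `V` of program variables these are the
states of the program. -/
abbrev Val {S : Signature} (M : Struc S) (X : Vars S) : Type :=
  (t : Ty S.Srt) → X t → M.den t

/-- The valuation of `A.sum B` given by a valuation of `A` and one of `B`. -/
def Val.sum {S : Signature} {M : Struc S} {A B : Vars S} (a : Val M A) (b : Val M B) :
    Val M (A.sum B) := fun t => Sum.elim (a t) (b t)

/-- The valuation of a single variable. -/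
def Val.single {S : Signature} {M : Struc S} {t : Ty S.Srt} (d : M.den t) : Val M (Single t)
  | _, .mk => d

/-- A (semantic) interpretation of the uninterpreted predicate symbols: arbitrary relations. -/
abbrev Interp {S : Signature} (M : Struc S) : Type 1 := (p : PredSym S) → Val M p.arity → Prop

def Tm.eval {S : Signature} {M : Struc S} {X : Vars S} (v : Val M X) :
    {t : Ty S.Srt} → Tm S X t → M.den t
  | _, .var x => v _ x
  | _, .app f args => M.fn f (fun i => (args i).eval v)

/-- Truth of an assertion under an interpretation and a valuation. -/
def Fml.Sat {S : Signature} {M : Struc S} (I : Interp M) :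
    {X : Vars S} → Fml S X → Val M X → Prop
  | _, .tru, _ => True
  | _, .eq a b, v => a.eval v = b.eval v
  | _, .rel R args, v => M.rl R (fun i => (args i).eval v)
  | _, .holds b, v => b.eval v = true
  | _, .pred p args, v => I p (fun t x => (args t x).eval v)
  | _, .neg a, v => ¬ a.Sat I v
  | _, .and a b, v => a.Sat I v ∧ b.Sat I v
  | _, .or a b, v => a.Sat I v ∨ b.Sat I v
  | _, .all t a, v => ∀ d : M.den t, a.Sat I (Val.sum v (Val.single d))
  | _, .ex t a, v => ∃ d : M.den t, a.Sat I (Val.sum v (Val.single d))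

/-! ### Existential Horn clauses -/

/-- Clauses. `horn A B body head` is `∀ A, body → ∃ B, head`; `dwf r V` says that the predicate
of arity `2|V|` with name `r` is disjunctively well-founded. -/
inductive Clause (S : Signature) : Type 1
  | horn (A B : Vars S) (body : Fml S A) (head : Fml S (A.sum B)) : Clause S
  | dwf (r : ℕ) (V : Vars S) : Clause S

/-- A clause without existential quantifier. -/
def Clause.plain {S : Signature} {A : Vars S} (body head : Fml S A) : Clause S :=
  .horn A Vars.none body (head.rename (fun _ => Sum.inl))

/-- A relation is disjunctively well-founded if it is a finite union of well-founded relations,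
where a relation `w` is well-founded if there is no infinite chain `w x₀ x₁`, `w x₁ x₂`, … -/
def DisjunctivelyWellFounded {α : Type} (r : α → α → Prop) : Prop :=
  ∃ (n : ℕ) (w : Fin n → α → α → Prop),
    (∀ i, WellFounded (fun x y => w i y x)) ∧ ∀ x y, r x y ↔ ∃ i, w i x y

/-- The interpretation `I` satisfies a clause. -/
def Clause.Sat {S : Signature} {M : Struc S} (I : Interp M) : Clause S → Prop
  | .horn A B body head =>
      ∀ a : Val M A, body.Sat I a → ∃ b : Val M B, head.Sat I (Val.sum a b)
  | .dwf r V => DisjunctivelyWellFounded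
      (fun s s' : Val M V => I ⟨r, V.sum V⟩ (Val.sum s s'))

/-! ### Programs and CTL* -/

/-- Programs (fair transition systems) with variables `V`. In `next`, the left copy
of `V` are the current and the right copy the next values of the variables. `fair` is
the set of fairness conditions. -/
structure Program {S : Signature} (V : Vars S) : Type 1 where
  init : Fml S V
  next : Fml S (V.sum V)
  fair : Set (Fml S V)

/-- The path quantifiers: `A`, `E`, and their fair versions. -/
inductive PathQ : Type
  | A | E | Af | Ef

mutual
/-- CTL* state formulas in negation normal form (assertions are closed under negation). -/
inductive SF {S : Signature} (V : Vars S) : Type 1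
  | asrt (c : Fml S V) : SF V
  | and (a b : SF V) : SF V
  | or (a b : SF V) : SF V
  | quant (Q : PathQ) (π : PF V) : SF V
/-- CTL* path formulas in negation normal form. -/
inductive PF {S : Signature} (V : Vars S) : Type 1
  | state (a : SF V) : PF V
  | and (a b : PF V) : PF V
  | or (a b : PF V) : PF V
  | X (a : PF V) : PF V
  | G (a : PF V) : PF V
  | U (a b : PF V) : PF V
end

/-- The infinite paths of a program. -/
def Program.IsPath {S : Signature} {M : Struc S} {V : Vars S} (D : Program V) (I : Interp M)
    (p : ℕ → Val M V) : Prop :=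
  ∀ i, D.next.Sat I (Val.sum (p i) (p (i + 1)))

/-- A path is fair if each fairness condition holds infinitely often along it. -/
def Program.IsFair {S : Signature} {M : Struc S} {V : Vars S} (D : Program V) (I : Interp M)
    (p : ℕ → Val M V) : Prop :=
  ∀ c ∈ D.fair, ∀ n, ∃ m, n ≤ m ∧ c.Sat I (p m)

mutual
/-- Truth of a state formula in a state. -/
def SF.Sat {S : Signature} {M : Struc S} {V : Vars S} (D : Program V) (I : Interp M) :
    SF V → Val M V → Prop
  | .asrt c, s => c.Sat I s
  | .and a b, s => a.Sat D I s ∧ b.Sat D I s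
  | .or a b, s => a.Sat D I s ∨ b.Sat D I s
  | .quant .A π, s => ∀ p, D.IsPath I p → p 0 = s → π.Sat D I p
  | .quant .E π, s => ∃ p, D.IsPath I p ∧ p 0 = s ∧ π.Sat D I p
  | .quant .Af π, s => ∀ p, D.IsPath I p → D.IsFair I p → p 0 = s → π.Sat D I p
  | .quant .Ef π, s => ∃ p, D.IsPath I p ∧ D.IsFair I p ∧ p 0 = s ∧ π.Sat D I p
/-- Truth of a path formula along a path. -/
def PF.Sat {S : Signature} {M : Struc S} {V : Vars S} (D : Program V) (I : Interp M) :
    PF V → (ℕ → Val M V) → Prop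
  | .state a, p => a.Sat D I (p 0)
  | .and a b, p => a.Sat D I p ∧ b.Sat D I p
  | .or a b, p => a.Sat D I p ∨ b.Sat D I p
  | .X a, p => a.Sat D I (fun i => p (i + 1))
  | .G a, p => ∀ k, a.Sat D I (fun i => p (i + k))
  | .U a b, p => ∃ k, b.Sat D I (fun i => p (i + k)) ∧ ∀ j < k, a.Sat D I (fun i => p (i + j))
end

/-- `D ⊨ φ`: the state formula holds in all initial states. -/
def Program.Satisfies {S : Signature} {M : Struc S} {V : Vars S} (D : Program V) (I : Interp M)
    (φ : SF V) : Prop :=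
  ∀ s : Val M V, D.init.Sat I s → φ.Sat D I s

/-! ### Syntactic operations on programs and formulas -/

/-- The assertion that a state formula without path quantifiers is. -/
def SF.assertion {S : Signature} {V : Vars S} : SF V → Option (Fml S V)
  | .asrt c => some c
  | .and a b => a.assertion.bind fun x => b.assertion.map fun y => .and x y
  | .or a b => a.assertion.bind fun x => b.assertion.map fun y => .or x y
  | .quant _ _ => none

/-- The assertion that a path formula without path quantifiers and temporal operators is. -/
def PF.assertion {S : Signature} {V : Vars S} : PF V → Option (Fml S V)
  | .state a => a.assertion
  | .and a b => a.assertion.bind fun x => b.assertion.map fun y => .and x y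
  | .or a b => a.assertion.bind fun x => b.assertion.map fun y => .or x y
  | .X _ => none
  | .G _ => none
  | .U _ _ => none

/-- Path formulas without path quantifiers. -/
def PF.QuantifierFree {S : Signature} {V : Vars S} : PF V → Prop
  | .state a => a.assertion.isSome = true
  | .and a b => a.QuantifierFree ∧ b.QuantifierFree
  | .or a b => a.QuantifierFree ∧ b.QuantifierFree
  | .X a => a.QuantifierFree
  | .G a => a.QuantifierFree
  | .U a b => a.QuantifierFree ∧ b.QuantifierFree

/-- Basic state formulas: one path quantifier in front of a path formula without any. -/
def SF.IsBasic {S : Signature} {V : Vars S} (φ : SF V) : Prop :=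
  ∃ (Q : PathQ) (π : PF V), φ = .quant Q π ∧ π.QuantifierFree

mutual
/-- The state formula `φ` occurs in a state formula. -/
def SF.Occurs {S : Signature} {V : Vars S} (φ : SF V) : SF V → Prop
  | .asrt c => φ = .asrt c
  | .and a b => φ = .and a b ∨ SF.Occurs φ a ∨ SF.Occurs φ b
  | .or a b => φ = .or a b ∨ SF.Occurs φ a ∨ SF.Occurs φ b
  | .quant Q π => φ = .quant Q π ∨ PF.OccursState φ π
/-- The state formula `φ` occurs in a path formula. -/
def PF.OccursState {S : Signature} {V : Vars S} (φ : SF V) : PF V → Prop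
  | .state a => SF.Occurs φ a
  | .and a b => PF.OccursState φ a ∨ PF.OccursState φ b
  | .or a b => PF.OccursState φ a ∨ PF.OccursState φ b
  | .X a => PF.OccursState φ a
  | .G a => PF.OccursState φ a
  | .U a b => PF.OccursState φ a ∨ PF.OccursState φ b
end

open Classical in
mutual
/-- Replacement of every occurrence of the state formula `φ` by the state formula `γ`. -/
noncomputable def SF.replace {S : Signature} {V : Vars S} (φ γ : SF V) : SF V → SF V
  | .asrt c => if φ = .asrt c then γ else .asrt c
  | .and a b => if φ = .and a b then γ else .and (SF.replace φ γ a) (SF.replace φ γ b)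
  | .or a b => if φ = .or a b then γ else .or (SF.replace φ γ a) (SF.replace φ γ b)
  | .quant Q π => if φ = .quant Q π then γ else .quant Q (PF.replaceState φ γ π)
/-- Replacement of every occurrence of the state formula `φ` by the state formula `γ`. -/
noncomputable def PF.replaceState {S : Signature} {V : Vars S} (φ γ : SF V) : PF V → PF V
  | .state a => .state (SF.replace φ γ a)
  | .and a b => .and (PF.replaceState φ γ a) (PF.replaceState φ γ b)
  | .or a b => .or (PF.replaceState φ γ a) (PF.replaceState φ γ b)
  | .X a => .X (PF.replaceState φ γ a)
  | .G a => .G (PF.replaceState φ γ a)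
  | .U a b => .U (PF.replaceState φ γ a) (PF.replaceState φ γ b)
end

/-- The path formula `θ` occurs in a path formula (not in the scope of a path quantifier). -/
def PF.Occurs {S : Signature} {V : Vars S} (θ : PF V) : PF V → Prop
  | .state a => θ = .state a
  | .and a b => θ = .and a b ∨ PF.Occurs θ a ∨ PF.Occurs θ b
  | .or a b => θ = .or a b ∨ PF.Occurs θ a ∨ PF.Occurs θ b
  | .X a => θ = .X a ∨ PF.Occurs θ a
  | .G a => θ = .G a ∨ PF.Occurs θ a
  | .U a b => θ = .U a b ∨ PF.Occurs θ a ∨ PF.Occurs θ b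

open Classical in
/-- Replacement of every occurrence (not in the scope of a path quantifier) of the path formula
`θ` by the path formula `γ`. -/
noncomputable def PF.replace {S : Signature} {V : Vars S} (θ γ : PF V) : PF V → PF V
  | .state a => if θ = .state a then γ else .state a
  | .and a b => if θ = .and a b then γ else .and (PF.replace θ γ a) (PF.replace θ γ b)
  | .or a b => if θ = .or a b then γ else .or (PF.replace θ γ a) (PF.replace θ γ b)
  | .X a => if θ = .X a then γ else .X (PF.replace θ γ a)
  | .G a => if θ = .G a then γ else .G (PF.replace θ γ a)
  | .U a b => if θ = .U a b then γ else .U (PF.replace θ γ a) (PF.replace θ γ b)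

mutual
/-- Renaming of the program variables in a state formula. -/
def SF.rename {S : Signature} {V W : Vars S} (f : Ren V W) : SF V → SF W
  | .asrt c => .asrt (c.rename f)
  | .and a b => .and (a.rename f) (b.rename f)
  | .or a b => .or (a.rename f) (b.rename f)
  | .quant Q π => .quant Q (π.rename f)
/-- Renaming of the program variables in a path formula. -/
def PF.rename {S : Signature} {V W : Vars S} (f : Ren V W) : PF V → PF W
  | .state a => .state (a.rename f)
  | .and a b => .and (a.rename f) (b.rename f)
  | .or a b => .or (a.rename f) (b.rename f)
  | .X a => .X (a.rename f)
  | .G a => .G (a.rename f)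
  | .U a b => .U (a.rename f) (b.rename f)
end

mutual
/-- The uninterpreted predicate symbols that occur in a state formula. -/
def SF.preds {S : Signature} {V : Vars S} : SF V → Set (PredSym S)
  | .asrt c => c.preds
  | .and a b => a.preds ∪ b.preds
  | .or a b => a.preds ∪ b.preds
  | .quant _ π => π.preds
/-- The uninterpreted predicate symbols that occur in a path formula. -/
def PF.preds {S : Signature} {V : Vars S} : PF V → Set (PredSym S)
  | .state a => a.preds
  | .and a b => a.preds ∪ b.preds
  | .or a b => a.preds ∪ b.preds
  | .X a => a.preds
  | .G a => a.preds
  | .U a b => a.preds ∪ b.preds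
end

/-- The uninterpreted predicate symbols that occur in a program. -/
def Program.preds {S : Signature} {V : Vars S} (D : Program V) : Set (PredSym S) :=
  D.init.preds ∪ D.next.preds ∪ {p | ∃ c ∈ D.fair, p ∈ c.preds}

/-- No symbol in `N` occurs in the verification problem `(D, φ)`. -/
def Fresh {S : Signature} {V : Vars S} (N : Set (PredSym S)) (D : Program V) (φ : SF V) : Prop :=
  Disjoint N (D.preds ∪ φ.preds)

/-! ### The translation system -/

/-- The program variables together with one new Boolean variable `x`. -/
abbrev Vars.withBool {S : Signature} (V : Vars S) : Vars S := V.ext Ty.bool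

/-- The embedding of the old variables. -/
def old {S : Signature} {V : Vars S} : Ren V V.withBool := fun _ x => Sum.inl x

/-- Assertion: the new Boolean variable is true. -/
def newVar {S : Signature} {V : Vars S} : Fml S V.withBool :=
  .holds (.var (Sum.inr Single.mk))

/-- An assertion over `V`, read over the current values of the variables. -/
def Fml.cur {S : Signature} {V : Vars S} (c : Fml S V) : Fml S (V.sum V) :=
  c.rename (fun _ => Sum.inl)

/-- An assertion over `V`, read over the next values of the variables. -/
def Fml.nxt {S : Signature} {V : Vars S} (c : Fml S V) : Fml S (V.sum V) :=
  c.rename (fun _ => Sum.inr)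

/-- An assertion over `V`, read over the `i`-th copy of the variables. -/
def Fml.on {S : Signature} {V : Vars S} {k : ℕ} (c : Fml S V) (i : Fin k) :
    Fml S (V.copies k) :=
  c.rename (fun _ x => (i, x))

/-- An assertion over two copies of `V`, read over the `i`-th and the `j`-th copy. -/
def Fml.on₂ {S : Signature} {V : Vars S} {k : ℕ} (c : Fml S (V.sum V)) (i j : Fin k) :
    Fml S (V.copies k) :=
  c.rename (fun _ => Sum.elim (fun x => (i, x)) (fun x => (j, x)))

/-- The predicate with the name `p` and arity `|v|`, applied to `v`. -/
def unary {S : Signature} {V : Vars S} (p : ℕ) : Fml S V :=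
  Fml.papp ⟨p, V⟩ (fun _ x => x)

/-- The predicate with the name `r` and arity `2|v|`, applied to `v, v'`. -/
def binary {S : Signature} {V : Vars S} (r : ℕ) : Fml S (V.sum V) :=
  Fml.papp ⟨r, V.sum V⟩ (fun _ x => x)

/-- `Tester θ R F`: the temporal formula `θ`, one of `X c`, `G c`, `c₁ U c₂` with assertions
`c`, `c₁`, `c₂`, is represented by a new Boolean variable `x` subject to
the additional transition constraint `R` and the additional fairness conditions `F`. -/
inductive Tester {S : Signature} {V : Vars S} :
    PF V → Fml S (V.withBool.sum V.withBool) → Set (Fml S V.withBool) → Prop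
  | X (a : PF V) (c : Fml S V) (hc : a.assertion = some c) :
      Tester (.X a)
        (.iff newVar.cur (c.rename old).nxt)
        ∅
  | G (a : PF V) (c : Fml S V) (hc : a.assertion = some c) :
      Tester (.G a)
        (.iff newVar.cur (.and (c.rename old).cur newVar.nxt))
        {.or newVar (.neg (c.rename old))}
  | U (a₁ a₂ : PF V) (c₁ c₂ : Fml S V)
      (hc₁ : a₁.assertion = some c₁) (hc₂ : a₂.assertion = some c₂) :
      Tester (.U a₁ a₂)
        (.iff newVar.cur (.or (c₂.rename old).cur (.and (c₁.rename old).cur newVar.nxt)))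
        {.or (.neg newVar) (c₂.rename old)}

/-- The program over `V ∪ {x}` with initial condition `ini`, the transition relation
strengthened by `R`, and the additional fairness conditions `F`. -/
def Program.extend {S : Signature} {V : Vars S} (D : Program V) (ini : Fml S V.withBool)
    (R : Fml S (V.withBool.sum V.withBool)) (F : Set (Fml S V.withBool)) :
    Program V.withBool where
  init := ini
  next := .and (D.next.rename (fun t => Sum.map (old t) (old t))) R
  fair := (fun c => c.rename old) '' D.fair ∪ F

/-- The path formula `π` over `V`, read over `V ∪ {x}`, with every occurrence of `θ` replaced
by the assertion `x`. -/
noncomputable def PF.elim {S : Signature} {V : Vars S} (π θ : PF V) : PF V.withBool :=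
  PF.replace (θ.rename old) (.state (.asrt newVar)) (π.rename old)

/-- `J` enumerates the set of fairness conditions of `D`. -/
def Program.Enumerates {S : Signature} {V : Vars S} (D : Program V) (J : List (Fml S V)) : Prop :=
  J.Nodup ∧ ∀ c, c ∈ J ↔ c ∈ D.fair

/-- The clauses for `A_f c`, with predicates named `p`, `r`, `t` and with the fairness
conditions enumerated by `J`. -/
def clausesAf {S : Signature} {V : Vars S} (D : Program V) (J : List (Fml S V)) (c : Fml S V)
    (p r t : ℕ) :
    Set (Clause S) :=
  { .plain (.and D.init (.neg c)) (unary p),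
    .plain (.and D.next (unary p).cur) (unary p).nxt,
    if J.length = 0 then
      .plain (.and (unary p).cur (binary t)) (binary (V := V) r)
    else
      .plain
        (.and ((unary p).on (0 : Fin (J.length + 1)))
          (Fml.conj (List.ofFn fun i : Fin J.length =>
            .and ((binary t).on₂ i.castSucc i.succ) ((J.get i).on i.succ))))
        ((binary (V := V) r).on₂ 0 (Fin.last J.length)),
    .dwf r V,
    .plain D.next (binary t),
    .plain (.and ((binary t).on₂ 0 1) (D.next.on₂ 1 2)) ((binary (V := V) t).on₂ (0 : Fin 3) 2) }

/-- The cyclic successor on the indices `0, …, k - 1`. -/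
def cyc {k : ℕ} (i : Fin k) : Fin k :=
  ⟨(i.val + 1) % k, Nat.mod_lt _ (Nat.lt_of_le_of_lt (Nat.zero_le _) i.isLt)⟩

/-- The clauses for `E_f c` with a nonempty set of fairness conditions, enumerated
by `J`, with predicates named `q i` and `r i`. The indices start at `0`. -/
def clausesEf {S : Signature} {V : Vars S} (D : Program V) (J : List (Fml S V)) (c : Fml S V)
    (h : 0 < J.length) (q r : Fin J.length → ℕ) : Set (Clause S) :=
  {.plain D.init (.and c (unary (q ⟨0, h⟩)))} ∪
  {κ | ∃ i : Fin J.length,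
    κ = .horn V V (unary (q i))
      (.and D.next
        (.or (.and (J.get i).cur (unary (q (cyc i))).nxt)
          (.and (binary (r i)) (unary (q i)).nxt))) ∨
    κ = .dwf (r i) V ∨
    κ = .plain (.and ((binary (r i)).on₂ 0 1) ((binary (r i)).on₂ 1 2))
      ((binary (V := V) (r i)).on₂ (0 : Fin 3) 2)}

/-- The clauses for `E_f c` with the empty set of fairness conditions. -/
def clausesEfEmpty {S : Signature} {V : Vars S} (D : Program V) (c : Fml S V) (q : ℕ) :
    Set (Clause S) :=
  { .plain D.init (.and c (unary q)),
    .horn V V (unary q) (.and D.next (unary q).nxt) }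

/-- `Trans D φ N C`: the translation system can produce the set of clauses `C` for the
verification problem `(D, φ)`, introducing the new predicate symbols `N`. -/
inductive Trans {S : Signature} : {V : Vars S} → Program V → SF V →
    Set (PredSym S) → Set (Clause S) → Prop
  /-- Replacement of a basic state subformula by a new predicate. -/
  | basicSub {V : Vars S} (D : Program V) (φ₂ φ₁ : SF V) (aux : ℕ)
      (N₁ N₂ : Set (PredSym S)) (C₁ C₂ : Set (Clause S))
      (hbasic : φ₁.IsBasic) (hocc : SF.Occurs φ₁ φ₂)
      (hN : Disjoint N₁ N₂) (haux : (⟨aux, V⟩ : PredSym S) ∉ N₁ ∪ N₂)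
      (hfresh : Fresh (insert ⟨aux, V⟩ (N₁ ∪ N₂)) D φ₂)
      (h₁ : Trans { D with init := unary aux } φ₁ N₁ C₁)
      (h₂ : Trans D (SF.replace φ₁ (.asrt (unary aux)) φ₂) N₂ C₂) :
      Trans D φ₂ (insert ⟨aux, V⟩ (N₁ ∪ N₂)) (C₁ ∪ C₂)
  /-- Elimination of `A`. -/
  | unfairA {V : Vars S} (D : Program V) (π : PF V) (N : Set (PredSym S)) (C : Set (Clause S))
      (hπ : π.QuantifierFree) (hfresh : Fresh N D (.quant .A π))
      (h : Trans { D with fair := ∅ } (.quant .Af π) N C) :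
      Trans D (.quant .A π) N C
  /-- Elimination of `E`. -/
  | unfairE {V : Vars S} (D : Program V) (π : PF V) (N : Set (PredSym S)) (C : Set (Clause S))
      (hπ : π.QuantifierFree) (hfresh : Fresh N D (.quant .E π))
      (h : Trans { D with fair := ∅ } (.quant .Ef π) N C) :
      Trans D (.quant .E π) N C
  /-- Elimination of a temporal operator (next, globally, until) under `A_f`. -/
  | temporalAf {V : Vars S} (D : Program V) (π θ : PF V)
      (R : Fml S (V.withBool.sum V.withBool)) (F : Set (Fml S V.withBool))
      (N : Set (PredSym S)) (C : Set (Clause S))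
      (hπ : π.QuantifierFree) (hocc : PF.Occurs θ π) (hθ : Tester θ R F)
      (hfresh : Fresh N D (.quant .Af π))
      (h : Trans (D.extend (D.init.rename old) R F) (.quant .Af (π.elim θ)) N C) :
      Trans D (.quant .Af π) N C
  /-- Elimination of a temporal operator (next, globally, until) under `E_f`. -/
  | temporalEf {V : Vars S} (D : Program V) (π θ : PF V)
      (R : Fml S (V.withBool.sum V.withBool)) (F : Set (Fml S V.withBool)) (aux : ℕ)
      (N : Set (PredSym S)) (C : Set (Clause S))
      (hπ : π.QuantifierFree) (hocc : PF.Occurs θ π) (hθ : Tester θ R F)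
      (haux : (⟨aux, V.withBool⟩ : PredSym S) ∉ N)
      (hfresh : Fresh (insert ⟨aux, V.withBool⟩ N) D (.quant .Ef π))
      (h : Trans (D.extend (unary aux) R F) (.quant .Ef (π.elim θ)) N C) :
      Trans D (.quant .Ef π) (insert ⟨aux, V.withBool⟩ N)
        (insert (.horn V (Single Ty.bool) D.init (unary aux)) C)
  /-- The formula `A_f c` with an assertion `c`. -/
  | baseAf {V : Vars S} (D : Program V) (π : PF V) (c : Fml S V) (J : List (Fml S V))
      (p r t : ℕ) (hJ : D.Enumerates J)
      (hc : π.assertion = some c) (hpr : p ≠ r) (hpt : p ≠ t) (hrt : r ≠ t)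
      (hfresh : Fresh {⟨p, V⟩, ⟨r, V.sum V⟩, ⟨t, V.sum V⟩} D (.quant .Af π)) :
      Trans D (.quant .Af π) {⟨p, V⟩, ⟨r, V.sum V⟩, ⟨t, V.sum V⟩} (clausesAf D J c p r t)
  /-- The formula `E_f c` with an assertion `c`, with fairness conditions. -/
  | baseEf {V : Vars S} (D : Program V) (π : PF V) (c : Fml S V) (J : List (Fml S V))
      (hJ : D.Enumerates J) (hlen : 0 < J.length) (q r : Fin J.length → ℕ)
      (hc : π.assertion = some c) (hqr : Function.Injective (Sum.elim q r))
      (hfresh : Fresh {P | ∃ i, P = ⟨q i, V⟩ ∨ P = ⟨r i, V.sum V⟩} D (.quant .Ef π)) :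
      Trans D (.quant .Ef π) {P | ∃ i, P = ⟨q i, V⟩ ∨ P = ⟨r i, V.sum V⟩}
        (clausesEf D J c hlen q r)
  /-- The formula `E_f c` with an assertion `c`, without fairness conditions. -/
  | baseEfEmpty {V : Vars S} (D : Program V) (π : PF V) (c : Fml S V) (hJ : D.fair = ∅)
      (q : ℕ) (hc : π.assertion = some c) (hfresh : Fresh {⟨q, V⟩} D (.quant .Ef π)) :
      Trans D (.quant .Ef π) {⟨q, V⟩} (clausesEfEmpty D c q)
  /-- An assertion `c`. -/
  | assertion {V : Vars S} (D : Program V) (φ : SF V) (c : Fml S V)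
      (hc : φ.assertion = some c) :
      Trans D φ ∅ {.plain D.init c}

end CTLStar

/-!
The new predicates are interpreted along the derivation, each by the relation it is meant to
describe.

* For `A_f c`: `p` is reachability from initial states that violate `c`, `t` is the transitive
  closure of the transition relation, and `r` relates a state in `p` to the end of a run that meets
  every fairness condition. An infinite chain for `r` concatenates to a fair path
  (`Program.fairPathFrom_of_rounds`), which can be continued backwards to an initial
  state violating `c`; so `r` itself is well-founded.
* For `E_f c`: every `q i` holds in the states from which a fair path starts, and `r i` is the
  decrease of the distance, along fair paths, to the `i`-th fairness condition.
* A Boolean variable introduced for `X c`, `G c` or `c₁ U c₂` has the truth value of that formula on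
  every fair path of the extended program (`Tester.newVar_sat_iff`), and every fair path can be
  annotated with these truth values (`Tester.annotate`). Under `E_f`, `aux` holds in the
  states with which an annotated fair path begins.
* A predicate that replaces a basic state formula is the set of states in which the formula holds.

In the last case the interpretations for two sets of clauses have to be combined, and the clauses of
the first set must survive the interpretation of the symbols of the second. Therefore the
induction (`Trans.exists_interp`) yields an interpretation `I` such that the clauses hold under
everything that agrees with `I` on the new symbols and on those of the verification problem.
Freshness gives that truth in the program is unaffected throughout (`Program.satisfies_congr`).
-/

namespace CTLStar

variable {S : Signature} {M : Struc S}

/-! ### Renaming and the symbols of assertions -/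

lemma Tm.eval_rename {X Y : Vars S} (f : Ren X Y) (v : Val M Y) {t : Ty S.Srt} (a : Tm S X t) :
    (a.rename f).eval v = a.eval (fun t x => v t (f t x)) := by
  induction a with
  | var x => rfl
  | app g args ih => simp only [Tm.rename, Tm.eval, ih]

lemma Val.sum_map {X Y Z : Vars S} (f : Ren X Y) (v : Val M Y) (w : Val M Z) :
    (fun t x => Val.sum v w t (Sum.map (f t) id x)) = Val.sum (fun t x => v t (f t x)) w := by
  funext t x
  cases x <;> rfl

lemma Fml.sat_rename (I : Interp M) {X : Vars S} (a : Fml S X) :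
    ∀ {Y : Vars S} (f : Ren X Y) (v : Val M Y),
      (a.rename f).Sat I v ↔ a.Sat I (fun t x => v t (f t x)) := by
  induction a with
  | tru => intros; rfl
  | eq a b => intros; simp only [Fml.rename, Fml.Sat, Tm.eval_rename]
  | rel R args => intros; simp only [Fml.rename, Fml.Sat, Tm.eval_rename]
  | holds b => intros; simp only [Fml.rename, Fml.Sat, Tm.eval_rename]
  | pred p args => intros; simp only [Fml.rename, Fml.Sat, Tm.eval_rename]
  | neg a ih => intros; simp only [Fml.rename, Fml.Sat, ih]
  | and a b iha ihb => intros; simp only [Fml.rename, Fml.Sat, iha, ihb]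
  | or a b iha ihb => intros; simp only [Fml.rename, Fml.Sat, iha, ihb]
  | all t a ih => intros; simp only [Fml.rename, Fml.Sat, ih, Val.sum_map]
  | ex t a ih => intros; simp only [Fml.rename, Fml.Sat, ih, Val.sum_map]

lemma Fml.preds_rename {X : Vars S} (a : Fml S X) :
    ∀ {Y : Vars S} (f : Ren X Y), (a.rename f).preds = a.preds := by
  induction a <;> intros <;> simp_all only [Fml.rename, Fml.preds]

/-- The interpretations `I` and `I'` give the same meaning to the symbols in `P`. -/
def AgreeOn (P : Set (PredSym S)) (I I' : Interp M) : Prop := ∀ p ∈ P, I p = I' p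

lemma AgreeOn.mono {P Q : Set (PredSym S)} {I I' : Interp M} (h : AgreeOn Q I I') (hPQ : P ⊆ Q) :
    AgreeOn P I I' := fun p hp => h p (hPQ hp)

lemma AgreeOn.trans {P : Set (PredSym S)} {I I' I'' : Interp M} (h : AgreeOn P I I')
    (h' : AgreeOn P I' I'') : AgreeOn P I I'' := fun p hp => (h p hp).trans (h' p hp)

lemma agreeOn_of_disjoint {N P : Set (PredSym S)} {I I' : Interp M} (hN : ∀ p, p ∉ N → I p = I' p)
    (h : Disjoint N P) : AgreeOn P I I' :=
  fun p hp => hN p (fun hpN => Set.disjoint_left.mp h hpN hp)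

lemma Fml.sat_congr {I I' : Interp M} {X : Vars S} (a : Fml S X) (h : AgreeOn a.preds I I') :
    ∀ v : Val M X, a.Sat I v ↔ a.Sat I' v := by
  induction a with
  | tru => intro v; rfl
  | eq a b => intro v; rfl
  | rel R args => intro v; rfl
  | holds b => intro v; rfl
  | pred p args => intro v; simp only [Fml.Sat, h p rfl]
  | neg a ih => intro v; simp only [Fml.Sat, ih h]
  | and a b iha ihb =>
    intro v
    simp only [Fml.Sat, iha (h.mono Set.subset_union_left), ihb (h.mono Set.subset_union_right)]
  | or a b iha ihb =>
    intro v
    simp only [Fml.Sat, iha (h.mono Set.subset_union_left), ihb (h.mono Set.subset_union_right)]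
  | all t a ih => intro v; simp only [Fml.Sat, ih h]
  | ex t a ih => intro v; simp only [Fml.Sat, ih h]

lemma Fml.sat_neg (I : Interp M) {X : Vars S} (a : Fml S X) (v : Val M X) :
    a.neg.Sat I v ↔ ¬ a.Sat I v := Iff.rfl

lemma Fml.sat_and (I : Interp M) {X : Vars S} (a b : Fml S X) (v : Val M X) :
    (a.and b).Sat I v ↔ a.Sat I v ∧ b.Sat I v := Iff.rfl

lemma Fml.sat_or (I : Interp M) {X : Vars S} (a b : Fml S X) (v : Val M X) :
    (a.or b).Sat I v ↔ a.Sat I v ∨ b.Sat I v := Iff.rfl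

lemma Fml.sat_iff (I : Interp M) {X : Vars S} (a b : Fml S X) (v : Val M X) :
    (Fml.iff a b).Sat I v ↔ (a.Sat I v ↔ b.Sat I v) := by
  simp only [Fml.iff, Fml.Sat]
  tauto

lemma Fml.sat_conj (I : Interp M) {X : Vars S} (l : List (Fml S X)) (v : Val M X) :
    (Fml.conj l).Sat I v ↔ ∀ a ∈ l, a.Sat I v := by
  induction l with
  | nil => simp [Fml.conj, Fml.Sat]
  | cons a l ih => simp [Fml.conj, Fml.Sat, ih]

lemma Fml.sat_cur (I : Interp M) {V : Vars S} (c : Fml S V) (s s' : Val M V) :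
    c.cur.Sat I (Val.sum s s') ↔ c.Sat I s :=
  c.sat_rename I _ _

lemma Fml.sat_nxt (I : Interp M) {V : Vars S} (c : Fml S V) (s s' : Val M V) :
    c.nxt.Sat I (Val.sum s s') ↔ c.Sat I s' :=
  c.sat_rename I _ _

/-- The state held by the `i`-th copy of the variables. -/
def Val.copy {V : Vars S} {k : ℕ} (a : Val M (V.copies k)) (i : Fin k) : Val M V :=
  fun t x => a t (i, x)

lemma Fml.sat_on (I : Interp M) {V : Vars S} {k : ℕ} (c : Fml S V) (i : Fin k)
    (a : Val M (V.copies k)) : (c.on i).Sat I a ↔ c.Sat I (a.copy i) :=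
  c.sat_rename I _ _

lemma Fml.sat_on₂ (I : Interp M) {V : Vars S} {k : ℕ} (c : Fml S (V.sum V)) (i j : Fin k)
    (a : Val M (V.copies k)) :
    (c.on₂ i j).Sat I a ↔ c.Sat I (Val.sum (a.copy i) (a.copy j)) := by
  have h : (fun t x => a t (Sum.elim (fun x => (i, x)) (fun x => (j, x)) x)) =
      Val.sum (a.copy i) (a.copy j) := by
    funext t x
    cases x <;> rfl
  rw [Fml.on₂, Fml.sat_rename, h]

lemma sat_unary (I : Interp M) {V : Vars S} (p : ℕ) (s : Val M V) :
    (unary (V := V) p).Sat I s ↔ I ⟨p, V⟩ s := Iff.rfl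

lemma sat_binary (I : Interp M) {V : Vars S} (r : ℕ) (s : Val M (V.sum V)) :
    (binary (V := V) r).Sat I s ↔ I ⟨r, V.sum V⟩ s := Iff.rfl

lemma Val.sum_inl_inr {A B : Vars S} (v : Val M (A.sum B)) :
    Val.sum (fun t x => v t (Sum.inl x)) (fun t x => v t (Sum.inr x)) = v := by
  funext t x
  cases x <;> rfl

lemma Clause.sat_plain (I : Interp M) {A : Vars S} (body head : Fml S A) :
    (Clause.plain body head).Sat I ↔ ∀ a : Val M A, body.Sat I a → head.Sat I a := by
  refine forall_congr' fun a => imp_congr_right fun _ => ?_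
  simp only [Fml.sat_rename]
  exact ⟨fun ⟨_, h⟩ => h, fun h => ⟨fun _ e => e.elim, h⟩⟩

/-- An assertion over `v, v'` can be checked on pairs of states. -/
lemma Clause.sat_plain_sum (I : Interp M) {A B : Vars S} (body head : Fml S (A.sum B)) :
    (Clause.plain body head).Sat I ↔ ∀ (s : Val M A) (s' : Val M B),
      body.Sat I (Val.sum s s') → head.Sat I (Val.sum s s') := by
  rw [Clause.sat_plain]
  refine ⟨fun h s s' => h _, fun h a => ?_⟩
  simpa only [Val.sum_inl_inr] using h (fun t x => a t (Sum.inl x)) (fun t x => a t (Sum.inr x))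

/-- A relation without infinite chains is disjunctively well-founded, as a union of one relation. -/
lemma DisjunctivelyWellFounded.of_no_chain {α : Type} {r : α → α → Prop}
    (h : ∀ f : ℕ → α, ¬ ∀ n, r (f n) (f (n + 1))) : DisjunctivelyWellFounded r :=
  ⟨1, fun _ => r, fun _ => wellFounded_iff_isEmpty_descending_chain.2 ⟨fun f => h f.1 f.2⟩,
    fun _ _ => by simp⟩

/-- An interpretation can be redefined on a family of distinct symbols at will. -/
lemma exists_interp_update {ι : Type*} (s : ι → PredSym S) (hs : Function.Injective s)
    (f : (i : ι) → Val M (s i).arity → Prop) (I₀ : Interp M) :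
    ∃ I : Interp M, (∀ p, p ∉ Set.range s → I p = I₀ p) ∧ ∀ i, I (s i) = f i := by
  classical
  refine ⟨fun p => if h : ∃ i, s i = p then h.choose_spec ▸ f h.choose else I₀ p,
    fun p hp => dif_neg hp, fun i => ?_⟩
  have key : ∀ j (e : s j = s i), e ▸ f j = f i := by
    intro j e
    obtain rfl := hs e
    rfl
  have hex : ∃ j, s j = s i := ⟨i, rfl⟩
  exact (dif_pos hex).trans (key _ _)

lemma exists_interp_update_single (q : PredSym S) (f : Val M q.arity → Prop) (I₀ : Interp M) :
    ∃ I : Interp M, (∀ p, p ≠ q → I p = I₀ p) ∧ I q = f := by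
  obtain ⟨I, hI, hf⟩ := exists_interp_update (fun _ : Unit => q)
    (Function.injective_of_subsingleton _) (fun _ => f) I₀
  exact ⟨I, fun p hp => hI p (fun ⟨_, h⟩ => hp h.symm), hf ()⟩

/-! ### The symbols of CTL* formulas -/

/-- Induction on state formulas without information on the path formulas in them. -/
@[elab_as_elim]
theorem SF.state_induction {V : Vars S} {motive : SF V → Prop} (asrt : ∀ c, motive (.asrt c))
    (and : ∀ a b, motive a → motive b → motive (.and a b))
    (or : ∀ a b, motive a → motive b → motive (.or a b))
    (quant : ∀ Q π, motive (.quant Q π)) : (a : SF V) → motive a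
  | .asrt c => asrt c
  | .and a b => and a b (state_induction asrt and or quant a) (state_induction asrt and or quant b)
  | .or a b => or a b (state_induction asrt and or quant a) (state_induction asrt and or quant b)
  | .quant Q π => quant Q π

/-- Induction on path formulas without information on the state formulas in them. -/
@[elab_as_elim]
theorem PF.path_induction {V : Vars S} {motive : PF V → Prop} (state : ∀ a, motive (.state a))
    (and : ∀ a b, motive a → motive b → motive (.and a b))
    (or : ∀ a b, motive a → motive b → motive (.or a b))
    (X : ∀ a, motive a → motive (.X a)) (G : ∀ a, motive a → motive (.G a))
    (U : ∀ a b, motive a → motive b → motive (.U a b)) : (π : PF V) → motive π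
  | .state a => state a
  | .and a b => and a b (path_induction state and or X G U a) (path_induction state and or X G U b)
  | .or a b => or a b (path_induction state and or X G U a) (path_induction state and or X G U b)
  | .X a => X a (path_induction state and or X G U a)
  | .G a => G a (path_induction state and or X G U a)
  | .U a b => U a b (path_induction state and or X G U a) (path_induction state and or X G U b)

mutual
lemma SF.preds_rename {V W : Vars S} (f : Ren V W) : (a : SF V) → (a.rename f).preds = a.preds
  | .asrt c => c.preds_rename f
  | .and a b => congrArg₂ _ (a.preds_rename f) (b.preds_rename f)
  | .or a b => congrArg₂ _ (a.preds_rename f) (b.preds_rename f)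
  | .quant _ π => π.preds_rename f
lemma PF.preds_rename {V W : Vars S} (f : Ren V W) : (a : PF V) → (a.rename f).preds = a.preds
  | .state a => a.preds_rename f
  | .and a b => congrArg₂ _ (a.preds_rename f) (b.preds_rename f)
  | .or a b => congrArg₂ _ (a.preds_rename f) (b.preds_rename f)
  | .X a => a.preds_rename f
  | .G a => a.preds_rename f
  | .U a b => congrArg₂ _ (a.preds_rename f) (b.preds_rename f)
end

mutual
lemma SF.preds_subset_of_occurs {V : Vars S} {φ : SF V} : (a : SF V) → SF.Occurs φ a →
    φ.preds ⊆ a.preds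
  | .asrt c, h => by rw [SF.Occurs] at h; rw [h]
  | .and a b, h => by
    rcases h with rfl | h | h
    · rfl
    · exact (SF.preds_subset_of_occurs a h).trans Set.subset_union_left
    · exact (SF.preds_subset_of_occurs b h).trans Set.subset_union_right
  | .or a b, h => by
    rcases h with rfl | h | h
    · rfl
    · exact (SF.preds_subset_of_occurs a h).trans Set.subset_union_left
    · exact (SF.preds_subset_of_occurs b h).trans Set.subset_union_right
  | .quant Q π, h => by
    rcases h with rfl | h
    · rfl
    · exact PF.preds_subset_of_occursState π h
lemma PF.preds_subset_of_occursState {V : Vars S} {φ : SF V} : (π : PF V) →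
    PF.OccursState φ π → φ.preds ⊆ π.preds
  | .state a, h => SF.preds_subset_of_occurs a h
  | .and a b, h => h.elim
      (fun h => (PF.preds_subset_of_occursState a h).trans Set.subset_union_left)
      (fun h => (PF.preds_subset_of_occursState b h).trans Set.subset_union_right)
  | .or a b, h => h.elim
      (fun h => (PF.preds_subset_of_occursState a h).trans Set.subset_union_left)
      (fun h => (PF.preds_subset_of_occursState b h).trans Set.subset_union_right)
  | .X a, h => PF.preds_subset_of_occursState a h
  | .G a, h => PF.preds_subset_of_occursState a h
  | .U a b, h => h.elim
      (fun h => (PF.preds_subset_of_occursState a h).trans Set.subset_union_left)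
      (fun h => (PF.preds_subset_of_occursState b h).trans Set.subset_union_right)
end

lemma PF.preds_subset_of_occurs {V : Vars S} {θ : PF V} (π : PF V) (h : PF.Occurs θ π) :
    θ.preds ⊆ π.preds := by
  have bin : ∀ a b : PF V, (PF.Occurs θ a → θ.preds ⊆ a.preds) →
      (PF.Occurs θ b → θ.preds ⊆ b.preds) → PF.Occurs θ a ∨ PF.Occurs θ b →
      θ.preds ⊆ a.preds ∪ b.preds := fun a b ha hb h =>
    h.elim (fun h => (ha h).trans Set.subset_union_left)
      (fun h => (hb h).trans Set.subset_union_right)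
  induction π using PF.path_induction with
  | state a => rw [PF.Occurs] at h; rw [h]
  | and a b iha ihb => exact h.elim (fun h => h ▸ subset_rfl) (bin a b iha ihb)
  | or a b iha ihb => exact h.elim (fun h => h ▸ subset_rfl) (bin a b iha ihb)
  | X a ih => exact h.elim (fun h => h ▸ subset_rfl) ih
  | G a ih => exact h.elim (fun h => h ▸ subset_rfl) ih
  | U a b iha ihb => exact h.elim (fun h => h ▸ subset_rfl) (bin a b iha ihb)

lemma union_subset_union_union {α : Type*} {A B A' B' C : Set α} (h : A' ⊆ A ∪ C)
    (h' : B' ⊆ B ∪ C) : A' ∪ B' ⊆ A ∪ B ∪ C :=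
  Set.union_subset
    (h.trans (Set.union_subset_union_left C Set.subset_union_left))
    (h'.trans (Set.union_subset_union_left C Set.subset_union_right))

mutual
lemma SF.preds_replace_subset {V : Vars S} (φ γ : SF V) : (a : SF V) →
    (SF.replace φ γ a).preds ⊆ a.preds ∪ γ.preds
  | .asrt c => by
    rw [SF.replace]
    split_ifs
    exacts [Set.subset_union_right, Set.subset_union_left]
  | .and a b => by
    rw [SF.replace]
    split_ifs
    exacts [Set.subset_union_right, union_subset_union_union
      (SF.preds_replace_subset φ γ a) (SF.preds_replace_subset φ γ b)]
  | .or a b => by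
    rw [SF.replace]
    split_ifs
    exacts [Set.subset_union_right, union_subset_union_union
      (SF.preds_replace_subset φ γ a) (SF.preds_replace_subset φ γ b)]
  | .quant Q π => by
    rw [SF.replace]
    split_ifs
    exacts [Set.subset_union_right, PF.preds_replaceState_subset φ γ π]
lemma PF.preds_replaceState_subset {V : Vars S} (φ γ : SF V) : (π : PF V) →
    (PF.replaceState φ γ π).preds ⊆ π.preds ∪ γ.preds
  | .state a => SF.preds_replace_subset φ γ a
  | .and a b => union_subset_union_union
      (PF.preds_replaceState_subset φ γ a) (PF.preds_replaceState_subset φ γ b)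
  | .or a b => union_subset_union_union
      (PF.preds_replaceState_subset φ γ a) (PF.preds_replaceState_subset φ γ b)
  | .X a => PF.preds_replaceState_subset φ γ a
  | .G a => PF.preds_replaceState_subset φ γ a
  | .U a b => union_subset_union_union
      (PF.preds_replaceState_subset φ γ a) (PF.preds_replaceState_subset φ γ b)
end

lemma PF.preds_replace_subset {V : Vars S} (θ γ : PF V) (π : PF V) :
    (PF.replace θ γ π).preds ⊆ π.preds ∪ γ.preds := by
  induction π using PF.path_induction with
  | state a =>
    rw [PF.replace]
    split_ifs
    exacts [Set.subset_union_right, Set.subset_union_left]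
  | and a b iha ihb =>
    rw [PF.replace]
    split_ifs
    exacts [Set.subset_union_right, union_subset_union_union iha ihb]
  | or a b iha ihb =>
    rw [PF.replace]
    split_ifs
    exacts [Set.subset_union_right, union_subset_union_union iha ihb]
  | X a ih =>
    rw [PF.replace]
    split_ifs
    exacts [Set.subset_union_right, ih]
  | G a ih =>
    rw [PF.replace]
    split_ifs
    exacts [Set.subset_union_right, ih]
  | U a b iha ihb =>
    rw [PF.replace]
    split_ifs
    exacts [Set.subset_union_right, union_subset_union_union iha ihb]

lemma SF.preds_assertion {V : Vars S} (a : SF V) :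
    ∀ c : Fml S V, a.assertion = some c → c.preds = a.preds := by
  induction a using SF.state_induction with
  | asrt c => rintro _ ⟨⟩; rfl
  | and a b iha ihb =>
    simp only [SF.assertion, Option.bind_eq_some_iff, Option.map_eq_some_iff]
    rintro _ ⟨x, hx, y, hy, rfl⟩
    exact congrArg₂ _ (iha x hx) (ihb y hy)
  | or a b iha ihb =>
    simp only [SF.assertion, Option.bind_eq_some_iff, Option.map_eq_some_iff]
    rintro _ ⟨x, hx, y, hy, rfl⟩
    exact congrArg₂ _ (iha x hx) (ihb y hy)
  | quant Q π => rintro _ ⟨⟩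

lemma PF.preds_assertion {V : Vars S} (a : PF V) :
    ∀ c : Fml S V, a.assertion = some c → c.preds = a.preds := by
  induction a using PF.path_induction with
  | state a => exact a.preds_assertion
  | and a b iha ihb =>
    simp only [PF.assertion, Option.bind_eq_some_iff, Option.map_eq_some_iff]
    rintro _ ⟨x, hx, y, hy, rfl⟩
    exact congrArg₂ _ (iha x hx) (ihb y hy)
  | or a b iha ihb =>
    simp only [PF.assertion, Option.bind_eq_some_iff, Option.map_eq_some_iff]
    rintro _ ⟨x, hx, y, hy, rfl⟩
    exact congrArg₂ _ (iha x hx) (ihb y hy)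
  | X a => rintro _ ⟨⟩
  | G a => rintro _ ⟨⟩
  | U a b => rintro _ ⟨⟩

/-! ### Truth of CTL* formulas -/

lemma Program.isPath_congr {V : Vars S} {D : Program V} {I I' : Interp M}
    (h : AgreeOn D.preds I I') (p : ℕ → Val M V) : D.IsPath I p ↔ D.IsPath I' p :=
  forall_congr' fun _ => D.next.sat_congr
    (h.mono (Set.subset_union_right.trans Set.subset_union_left)) _

lemma Program.sat_fair_congr {V : Vars S} {D : Program V} {I I' : Interp M}
    (h : AgreeOn D.preds I I') {c : Fml S V} (hc : c ∈ D.fair) (s : Val M V) :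
    c.Sat I s ↔ c.Sat I' s :=
  c.sat_congr (h.mono (fun _ hp => Or.inr ⟨c, hc, hp⟩)) s

lemma Program.isFair_congr {V : Vars S} {D : Program V} {I I' : Interp M}
    (h : AgreeOn D.preds I I') (p : ℕ → Val M V) : D.IsFair I p ↔ D.IsFair I' p :=
  forall₂_congr fun _ hc => forall_congr' fun _ => exists_congr fun _ =>
    and_congr_right fun _ => sat_fair_congr h hc _

mutual
lemma SF.sat_congr {V : Vars S} {D : Program V} {I I' : Interp M} (hD : AgreeOn D.preds I I') :
    (a : SF V) → AgreeOn a.preds I I' → ∀ s, a.Sat D I s ↔ a.Sat D I' s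
  | .asrt c, h, s => c.sat_congr h s
  | .and a b, h, s => and_congr (a.sat_congr hD (h.mono Set.subset_union_left) s)
      (b.sat_congr hD (h.mono Set.subset_union_right) s)
  | .or a b, h, s => or_congr (a.sat_congr hD (h.mono Set.subset_union_left) s)
      (b.sat_congr hD (h.mono Set.subset_union_right) s)
  | .quant Q π, h, s => by
    cases Q <;> simp only [SF.Sat, π.sat_congr hD h, D.isPath_congr hD, D.isFair_congr hD]
lemma PF.sat_congr {V : Vars S} {D : Program V} {I I' : Interp M} (hD : AgreeOn D.preds I I') :
    (a : PF V) → AgreeOn a.preds I I' → ∀ p, a.Sat D I p ↔ a.Sat D I' p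
  | .state a, h, p => a.sat_congr hD h (p 0)
  | .and a b, h, s => and_congr (a.sat_congr hD (h.mono Set.subset_union_left) s)
      (b.sat_congr hD (h.mono Set.subset_union_right) s)
  | .or a b, h, s => or_congr (a.sat_congr hD (h.mono Set.subset_union_left) s)
      (b.sat_congr hD (h.mono Set.subset_union_right) s)
  | .X a, h, _ => a.sat_congr hD h _
  | .G a, h, _ => forall_congr' fun _ => a.sat_congr hD h _
  | .U a b, h, _ => exists_congr fun _ => and_congr
      (b.sat_congr hD (h.mono Set.subset_union_right) _)
      (forall₂_congr fun _ _ => a.sat_congr hD (h.mono Set.subset_union_left) _)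
end

lemma Program.satisfies_congr {V : Vars S} {D : Program V} {I I' : Interp M} {φ : SF V}
    (h : AgreeOn (D.preds ∪ φ.preds) I I') : D.Satisfies I φ ↔ D.Satisfies I' φ := by
  have hD : AgreeOn D.preds I I' := h.mono Set.subset_union_left
  exact forall_congr' fun s => imp_congr
    (D.init.sat_congr (hD.mono (Set.subset_union_left.trans Set.subset_union_left)) s)
    (φ.sat_congr hD (h.mono Set.subset_union_right) s)

lemma SF.sat_assertion {V : Vars S} (D : Program V) (I : Interp M) (a : SF V) :
    ∀ c : Fml S V, a.assertion = some c → ∀ s, a.Sat D I s ↔ c.Sat I s := by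
  induction a using SF.state_induction with
  | asrt c => rintro _ ⟨⟩ s; rfl
  | and a b iha ihb =>
    simp only [SF.assertion, Option.bind_eq_some_iff, Option.map_eq_some_iff]
    rintro _ ⟨x, hx, y, hy, rfl⟩ s
    exact and_congr (iha x hx s) (ihb y hy s)
  | or a b iha ihb =>
    simp only [SF.assertion, Option.bind_eq_some_iff, Option.map_eq_some_iff]
    rintro _ ⟨x, hx, y, hy, rfl⟩ s
    exact or_congr (iha x hx s) (ihb y hy s)
  | quant Q π => rintro _ ⟨⟩

lemma PF.sat_assertion {V : Vars S} (D : Program V) (I : Interp M) (a : PF V) :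
    ∀ c : Fml S V, a.assertion = some c → ∀ p, a.Sat D I p ↔ c.Sat I (p 0) := by
  induction a using PF.path_induction with
  | state a => exact fun c hc p => a.sat_assertion D I c hc (p 0)
  | and a b iha ihb =>
    simp only [PF.assertion, Option.bind_eq_some_iff, Option.map_eq_some_iff]
    rintro _ ⟨x, hx, y, hy, rfl⟩ s
    exact and_congr (iha x hx s) (ihb y hy s)
  | or a b iha ihb =>
    simp only [PF.assertion, Option.bind_eq_some_iff, Option.map_eq_some_iff]
    rintro _ ⟨x, hx, y, hy, rfl⟩ s
    exact or_congr (iha x hx s) (ihb y hy s)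
  | X a => rintro _ ⟨⟩
  | G a => rintro _ ⟨⟩
  | U a b => rintro _ ⟨⟩

mutual
lemma SF.sat_replace {V : Vars S} {D : Program V} {I : Interp M} {φ γ : SF V}
    (h : ∀ s, γ.Sat D I s ↔ φ.Sat D I s) :
    (a : SF V) → ∀ s, (SF.replace φ γ a).Sat D I s ↔ a.Sat D I s
  | .asrt c, s => by
    rw [SF.replace]
    split_ifs with e
    · rw [h, e]
    · rfl
  | .and a b, s => by
    rw [SF.replace]
    split_ifs with e
    · rw [h, e]
    · exact and_congr (SF.sat_replace h a s) (SF.sat_replace h b s)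
  | .or a b, s => by
    rw [SF.replace]
    split_ifs with e
    · rw [h, e]
    · exact or_congr (SF.sat_replace h a s) (SF.sat_replace h b s)
  | .quant Q π, s => by
    rw [SF.replace]
    split_ifs with e
    · rw [h, e]
    · cases Q <;> simp only [SF.Sat, PF.sat_replaceState h π]
lemma PF.sat_replaceState {V : Vars S} {D : Program V} {I : Interp M} {φ γ : SF V}
    (h : ∀ s, γ.Sat D I s ↔ φ.Sat D I s) :
    (π : PF V) → ∀ p, (PF.replaceState φ γ π).Sat D I p ↔ π.Sat D I p
  | .state a, p => SF.sat_replace h a (p 0)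
  | .and a b, p => and_congr (PF.sat_replaceState h a p) (PF.sat_replaceState h b p)
  | .or a b, p => or_congr (PF.sat_replaceState h a p) (PF.sat_replaceState h b p)
  | .X a, _ => PF.sat_replaceState h a _
  | .G a, _ => forall_congr' fun _ => PF.sat_replaceState h a _
  | .U a b, _ => exists_congr fun _ => and_congr (PF.sat_replaceState h b _)
      (forall₂_congr fun _ _ => PF.sat_replaceState h a _)
end

/-- Replacing a path formula by one that is equivalent at every position of the path `p`. -/
lemma PF.sat_replace {V : Vars S} {D : Program V} {I : Interp M} {θ γ : PF V} (π : PF V) :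
    ∀ p : ℕ → Val M V,
      (∀ n, γ.Sat D I (fun i => p (i + n)) ↔ θ.Sat D I (fun i => p (i + n))) →
      ((PF.replace θ γ π).Sat D I p ↔ π.Sat D I p) := by
  have shift : ∀ p : ℕ → Val M V,
      (∀ n, γ.Sat D I (fun i => p (i + n)) ↔ θ.Sat D I (fun i => p (i + n))) → ∀ k n,
      (γ.Sat D I (fun i => p (i + n + k)) ↔ θ.Sat D I (fun i => p (i + n + k))) := by
    intro p h k n
    simpa only [add_assoc] using h (n + k)
  induction π using PF.path_induction with
  | state a =>
    intro p h
    rw [PF.replace]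
    split_ifs with e
    · rw [← e]; exact h 0
    · rfl
  | and a b iha ihb =>
    intro p h
    rw [PF.replace]
    split_ifs with e
    · rw [← e]; exact h 0
    · exact and_congr (iha p h) (ihb p h)
  | or a b iha ihb =>
    intro p h
    rw [PF.replace]
    split_ifs with e
    · rw [← e]; exact h 0
    · exact or_congr (iha p h) (ihb p h)
  | X a ih =>
    intro p h
    rw [PF.replace]
    split_ifs with e
    · rw [← e]; exact h 0
    · exact ih _ (shift p h 1)
  | G a ih =>
    intro p h
    rw [PF.replace]
    split_ifs with e
    · rw [← e]; exact h 0
    · exact forall_congr' fun k => ih _ (shift p h k)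
  | U a b iha ihb =>
    intro p h
    rw [PF.replace]
    split_ifs with e
    · rw [← e]; exact h 0
    · exact exists_congr fun k => and_congr (ihb _ (shift p h k))
        (forall₂_congr fun j _ => iha _ (shift p h j))

lemma SF.sat_rename {V W : Vars S} (D : Program V) (D' : Program W) (I : Interp M) (f : Ren V W)
    (a : SF V) : a.assertion.isSome = true → ∀ s : Val M W,
      (a.rename f).Sat D' I s ↔ a.Sat D I (fun t x => s t (f t x)) := by
  induction a using SF.state_induction with
  | asrt c => exact fun _ s => c.sat_rename I f s
  | and a b iha ihb =>
    intro h s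
    obtain ⟨c, hc⟩ := Option.isSome_iff_exists.mp h
    simp only [SF.assertion, Option.bind_eq_some_iff, Option.map_eq_some_iff] at hc
    obtain ⟨x, hx, y, hy, -⟩ := hc
    exact and_congr (iha (by simp [hx]) s) (ihb (by simp [hy]) s)
  | or a b iha ihb =>
    intro h s
    obtain ⟨c, hc⟩ := Option.isSome_iff_exists.mp h
    simp only [SF.assertion, Option.bind_eq_some_iff, Option.map_eq_some_iff] at hc
    obtain ⟨x, hx, y, hy, -⟩ := hc
    exact or_congr (iha (by simp [hx]) s) (ihb (by simp [hy]) s)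
  | quant Q π => intro h; cases h

/-- The truth of a path formula without path quantifiers depends on the path alone, not on
the program. -/
lemma PF.sat_rename {V W : Vars S} (D : Program V) (D' : Program W) (I : Interp M) (f : Ren V W)
    (π : PF V) : π.QuantifierFree → ∀ p : ℕ → Val M W,
      (π.rename f).Sat D' I p ↔ π.Sat D I (fun i t x => p i t (f t x)) := by
  induction π using PF.path_induction with
  | state a => exact fun h p => a.sat_rename D D' I f h (p 0)
  | and a b iha ihb => exact fun h p => and_congr (iha h.1 p) (ihb h.2 p)
  | or a b iha ihb => exact fun h p => or_congr (iha h.1 p) (ihb h.2 p)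
  | X a ih => exact fun h p => ih h _
  | G a ih => exact fun h p => forall_congr' fun k => ih h _
  | U a b iha ihb =>
    exact fun h p => exists_congr fun k => and_congr (ihb h.2 _)
      (forall₂_congr fun j _ => iha h.1 _)

lemma PF.sat_program {V : Vars S} (D D' : Program V) (I : Interp M) (π : PF V)
    (h : π.QuantifierFree) (p : ℕ → Val M V) : π.Sat D I p ↔ π.Sat D' I p :=
  (π.sat_rename D D I (fun _ x => x) h p).symm.trans (π.sat_rename D' D I (fun _ x => x) h p)

/-! ### Paths -/

/-- One step of the program. -/
def Program.Step {V : Vars S} (D : Program V) (I : Interp M) (s s' : Val M V) : Prop :=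
  D.next.Sat I (Val.sum s s')

/-- Some fair path of the program starts in `s`. -/
def Program.FairPathFrom {V : Vars S} (D : Program V) (I : Interp M) (s : Val M V) : Prop :=
  ∃ p, D.IsPath I p ∧ D.IsFair I p ∧ p 0 = s

lemma Program.IsPath.shift {V : Vars S} {D : Program V} {I : Interp M} {p : ℕ → Val M V}
    (h : D.IsPath I p) (k : ℕ) : D.IsPath I (fun i => p (i + k)) := by
  intro i
  simpa only [add_right_comm] using h (i + k)

lemma Program.IsFair.shift {V : Vars S} {D : Program V} {I : Interp M} {p : ℕ → Val M V}
    (h : D.IsFair I p) (k : ℕ) : D.IsFair I (fun i => p (i + k)) := by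
  intro c hc n
  obtain ⟨m, hm, hs⟩ := h c hc (n + k)
  refine ⟨m - k, by omega, ?_⟩
  rwa [← Nat.sub_add_cancel (show k ≤ m by omega)] at hs

lemma Program.FairPathFrom.of_step {V : Vars S} {D : Program V} {I : Interp M} {s s' : Val M V}
    (h : D.Step I s s') (h' : D.FairPathFrom I s') : D.FairPathFrom I s := by
  obtain ⟨p, hp, hf, rfl⟩ := h'
  refine ⟨fun i => Nat.casesOn i s p, fun i => ?_, fun c hc n => ?_, rfl⟩
  · cases i with
    | zero => exact h
    | succ i => exact hp i
  · obtain ⟨m, hm, hs⟩ := hf c hc n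
    exact ⟨m + 1, by omega, hs⟩

lemma exists_finite_path {α : Type*} {R : α → α → Prop} {x y : α} (h : Relation.TransGen R x y) :
    ∃ (L : ℕ) (f : ℕ → α), 0 < L ∧ f 0 = x ∧ f L = y ∧ ∀ i < L, R (f i) (f (i + 1)) := by
  induction h using Relation.TransGen.head_induction_on with
  | single h =>
    rename_i x
    refine ⟨1, fun i => Nat.casesOn i x (fun _ => y), one_pos, rfl, rfl, fun i hi => ?_⟩
    obtain rfl : i = 0 := by omega
    exact h
  | head h h' ih =>
    rename_i x z
    obtain ⟨L, f, -, rfl, hL, hf⟩ := ih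
    refine ⟨L + 1, fun i => Nat.casesOn i x f, by omega, rfl, hL, fun i hi => ?_⟩
    cases i with
    | zero => exact h
    | succ i => exact hf i (by omega)

/-- Infinitely many finite paths, each of which ends where the next one begins, concatenate to
an infinite path. -/
lemma exists_path_of_segments {α : Type*} {R : α → α → Prop} (L : ℕ → ℕ) (f : ℕ → ℕ → α)
    (hL : ∀ n, 0 < L n) (hend : ∀ n, f n (L n) = f (n + 1) 0)
    (hstep : ∀ n, ∀ i < L n, R (f n i) (f n (i + 1))) :
    ∃ g : ℕ → α, g 0 = f 0 0 ∧ (∀ m, R (g m) (g (m + 1))) ∧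
      ∀ n, ∃ m, n ≤ m ∧ ∀ i ≤ L n, g (m + i) = f n i := by
  -- The pair `(n, i)` is position `i` of segment `n`; its last position is skipped, being the
  -- first of the next segment.
  let next : ℕ × ℕ → ℕ × ℕ := fun q => if q.2 + 1 < L q.1 then (q.1, q.2 + 1) else (q.1 + 1, 0)
  let pos : ℕ → ℕ × ℕ := fun m => next^[m] (0, 0)
  have hpos : ∀ m, pos (m + 1) = next (pos m) := fun m => Function.iterate_succ_apply' _ _ _
  have hlt : ∀ m, (pos m).2 < L (pos m).1 := by
    intro m
    induction m with
    | zero => exact hL 0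
    | succ m ih =>
      rw [hpos]
      by_cases h : (pos m).2 + 1 < L (pos m).1
      · simpa only [next, if_pos h] using h
      · simpa only [next, if_neg h] using hL _
  have hsucc : ∀ m, f (pos (m + 1)).1 (pos (m + 1)).2 = f (pos m).1 ((pos m).2 + 1) := by
    intro m
    rw [hpos]
    by_cases h : (pos m).2 + 1 < L (pos m).1
    · simp only [next, if_pos h]
    · have h' : (pos m).2 + 1 = L (pos m).1 := by
        have := hlt m
        omega
      simp only [next, if_neg h, h', hend]
  have hseg : ∀ n m, pos m = (n, 0) → ∀ i < L n, pos (m + i) = (n, i) := by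
    intro n m hm i
    induction i with
    | zero => exact fun _ => hm
    | succ i ih =>
      intro hi
      rw [← add_assoc, hpos, ih (by omega)]
      simp only [next, if_pos hi]
  have hstart : ∀ n, ∃ m, n ≤ m ∧ pos m = (n, 0) := by
    intro n
    induction n with
    | zero => exact ⟨0, le_rfl, rfl⟩
    | succ n ih =>
      obtain ⟨m, hnm, hm⟩ := ih
      have hn := hL n
      have hlast := hseg n m hm (L n - 1) (by omega)
      refine ⟨m + (L n - 1) + 1, by omega, ?_⟩
      rw [hpos, hlast]
      simp only [next, Nat.sub_add_cancel hn, lt_irrefl, if_false]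
  refine ⟨fun m => f (pos m).1 (pos m).2, rfl, fun m => ?_, fun n => ?_⟩
  · simp only [hsucc]
    exact hstep _ _ (hlt m)
  · obtain ⟨m, hnm, hm⟩ := hstart n
    refine ⟨m, hnm, fun i hi => ?_⟩
    rcases hi.lt_or_eq with hi | rfl
    · simp only [hseg n m hm i hi]
    · have hn := hL n
      have hlast := hseg n m hm (L n - 1) (by omega)
      have e : m + L n = m + (L n - 1) + 1 := by omega
      simp only [e, hsucc, hlast, Nat.sub_add_cancel hn]

/-- `s'` is reached from `s` by at least one step, and every fairness condition is met on
the way. -/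
def Program.Round {V : Vars S} (D : Program V) (I : Interp M) (s s' : Val M V) : Prop :=
  ∃ (L : ℕ) (f : ℕ → Val M V), 0 < L ∧ f 0 = s ∧ f L = s' ∧
    (∀ i < L, Relation.TransGen (D.Step I) (f i) (f (i + 1))) ∧
    ∀ c ∈ D.fair, ∃ i ≤ L, c.Sat I (f i)

lemma Program.fairPathFrom_of_rounds {V : Vars S} {D : Program V} {I : Interp M}
    (s : ℕ → Val M V) (h : ∀ n, D.Round I (s n) (s (n + 1))) : D.FairPathFrom I (s 0) := by
  choose L f hL h0 h1 hstep hfair using h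
  -- The rounds are concatenated to a chain for the transitive closure, then its links to a path.
  obtain ⟨g, hg0, hg, hgf⟩ := exists_path_of_segments L f hL (fun n => (h1 n).trans (h0 _).symm)
    hstep
  choose K e hK he0 he1 hestep using fun m => exists_finite_path (hg m)
  obtain ⟨p, hp0, hp, hpe⟩ := exists_path_of_segments K e hK (fun n => (he1 n).trans (he0 _).symm)
    hestep
  refine ⟨p, hp, fun c hc n => ?_, by rw [hp0, he0, hg0, h0]⟩
  obtain ⟨i, hi, hci⟩ := hfair n c hc
  obtain ⟨m, hnm, hm⟩ := hgf n
  obtain ⟨m', hmm, hm'⟩ := hpe (m + i)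
  refine ⟨m', by omega, ?_⟩
  have := hm' 0 (Nat.zero_le _)
  rw [add_zero, he0, hm i hi] at this
  rwa [this]

/-! ### Universal path quantification over an assertion -/

/-- `s` is reachable from an initial state that violates `c`. -/
def Program.BadReach {V : Vars S} (D : Program V) (c : Fml S V) (I : Interp M) (s : Val M V) :
    Prop :=
  ∃ s₀, D.init.Sat I s₀ ∧ ¬ c.Sat I s₀ ∧ Relation.ReflTransGen (D.Step I) s₀ s

/-- If no fair path starts in an initial state that violates `c`, then the clauses for `A_f c`
hold when `p`, `t` and `r` are reachability from such states, the transitive closure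
of the transition relation, and the rounds from states satisfying `p`. -/
lemma clausesAf_sat {V : Vars S} {D : Program V} {J : List (Fml S V)} {c : Fml S V} {p r t : ℕ}
    {I I₀ : Interp M} (hJ : D.Enumerates J) (hD : AgreeOn D.preds I I₀)
    (hc : AgreeOn c.preds I I₀)
    (hp : ∀ s, I ⟨p, V⟩ s ↔ D.BadReach c I₀ s)
    (hr : ∀ s s', I ⟨r, V.sum V⟩ (Val.sum s s') ↔ D.BadReach c I₀ s ∧ D.Round I₀ s s')
    (ht : ∀ s s', I ⟨t, V.sum V⟩ (Val.sum s s') ↔ Relation.TransGen (D.Step I₀) s s')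
    (hsat : ∀ s, D.init.Sat I₀ s → ¬ c.Sat I₀ s → ¬ D.FairPathFrom I₀ s) :
    ∀ κ ∈ clausesAf D J c p r t, κ.Sat I := by
  have hinit : ∀ s, D.init.Sat I s ↔ D.init.Sat I₀ s :=
    D.init.sat_congr (hD.mono (Set.subset_union_left.trans Set.subset_union_left))
  have hnext : ∀ s s', D.next.Sat I (Val.sum s s') ↔ D.Step I₀ s s' := fun s s' =>
    D.next.sat_congr (hD.mono (Set.subset_union_right.trans Set.subset_union_left)) _
  have hcs := c.sat_congr hc
  rintro κ (rfl | rfl | rfl | rfl | rfl | rfl)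
  · rw [Clause.sat_plain]
    simp only [Fml.Sat, sat_unary, hinit, hcs, hp]
    exact fun s hs => ⟨s, hs.1, hs.2, .refl⟩
  · rw [Clause.sat_plain_sum]
    simp only [Fml.Sat, Fml.sat_cur, Fml.sat_nxt, sat_unary, hnext, hp]
    rintro s s' ⟨h, s₀, h₀, hc₀, hs⟩
    exact ⟨s₀, h₀, hc₀, hs.tail h⟩
  · split_ifs with hlen
    · rw [Clause.sat_plain_sum]
      simp only [Fml.Sat, Fml.sat_cur, sat_unary, sat_binary, hr, hp, ht]
      rintro s s' ⟨hs, hss⟩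
      refine ⟨hs, 1, fun i => Nat.casesOn i s (fun _ => s'), one_pos, rfl, rfl, fun i hi => ?_,
        fun d hd => ?_⟩
      · obtain rfl : i = 0 := by omega
        exact hss
      · rw [← hJ.2, List.length_eq_zero_iff.mp hlen] at hd
        cases hd
    · rw [Clause.sat_plain]
      simp only [Fml.Sat, Fml.sat_on, Fml.sat_on₂, Fml.sat_conj, sat_unary, sat_binary, hr, hp, ht,
        List.forall_mem_ofFn_iff]
      rintro a ⟨hs, hss⟩
      refine ⟨hs, J.length, fun i => a.copy (Fin.ofNat (J.length + 1) i), by omega, rfl, ?_,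
        fun i hi => ?_, fun d hd => ?_⟩
      · simp only [Fin.ofNat_eq_cast, Fin.natCast_eq_last]
      · convert (hss ⟨i, hi⟩).1 using 2
        · ext
          simp [Nat.mod_eq_of_lt (show i < J.length + 1 by omega)]
        · ext
          simp [Nat.mod_eq_of_lt (show i + 1 < J.length + 1 by omega)]
      · obtain ⟨i, rfl⟩ := List.get_of_mem ((hJ.2 d).2 hd)
        refine ⟨i + 1, i.isLt, ?_⟩
        have e : Fin.ofNat (J.length + 1) (i + 1) = i.succ := by
          ext
          simp [Nat.mod_eq_of_lt (show (i : ℕ) + 1 < J.length + 1 by omega)]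
        rw [← Program.sat_fair_congr hD hd]
        change (J.get i).Sat I (a.copy (Fin.ofNat (J.length + 1) (i + 1)))
        rw [e]
        exact (hss i).2
  · refine DisjunctivelyWellFounded.of_no_chain fun f hf => ?_
    simp only [hr] at hf
    obtain ⟨s₀, h₀, hc₀, hs⟩ := (hf 0).1
    refine hsat s₀ h₀ hc₀ ?_
    have := Program.fairPathFrom_of_rounds f (fun n => (hf n).2)
    clear h₀ hc₀
    induction hs using Relation.ReflTransGen.head_induction_on with
    | refl => exact this
    | head h _ ih => exact ih.of_step h
  · rw [Clause.sat_plain_sum]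
    simp only [sat_binary, hnext, ht]
    exact fun s s' h => .single h
  · rw [Clause.sat_plain]
    simp only [Fml.Sat, Fml.sat_on₂, sat_binary, hnext, ht]
    exact fun a h => h.1.tail h.2

/-! ### Existential path quantification over an assertion -/

/-- The least number of steps after which some fair path from `s` satisfies `c`
(and `0` if there is none). -/
noncomputable def Program.distance {V : Vars S} (D : Program V) (c : Fml S V) (I : Interp M)
    (s : Val M V) : ℕ :=
  sInf {n | ∃ p, D.IsPath I p ∧ D.IsFair I p ∧ p 0 = s ∧ c.Sat I (p n)}

lemma Program.exists_step_of_fairPathFrom {V : Vars S} {D : Program V} {I : Interp M}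
    {c : Fml S V} (hc : c ∈ D.fair) {s : Val M V} (h : D.FairPathFrom I s) :
    ∃ s', D.Step I s s' ∧ D.FairPathFrom I s' ∧
      (c.Sat I s ∨ D.distance c I s' < D.distance c I s) := by
  have hne : {n | ∃ p, D.IsPath I p ∧ D.IsFair I p ∧ p 0 = s ∧ c.Sat I (p n)}.Nonempty := by
    obtain ⟨p, hp, hf, h0⟩ := h
    obtain ⟨n, -, hn⟩ := hf c hc 0
    exact ⟨n, p, hp, hf, h0, hn⟩
  obtain ⟨p, hp, hf, rfl, hd⟩ := Nat.sInf_mem hne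
  refine ⟨p 1, hp 0, ⟨_, hp.shift 1, hf.shift 1, rfl⟩, ?_⟩
  change c.Sat I (p (D.distance c I (p 0))) at hd
  rcases Nat.eq_zero_or_pos (D.distance c I (p 0)) with h0 | hpos
  · rw [h0] at hd
    exact Or.inl hd
  · refine Or.inr (lt_of_le_of_lt (Nat.sInf_le (m := D.distance c I (p 0) - 1)
      ⟨_, hp.shift 1, hf.shift 1, rfl, ?_⟩) (Nat.sub_lt hpos one_pos))
    rwa [← Nat.sub_add_cancel (show 1 ≤ D.distance c I (p 0) from hpos)] at hd

/-- If `c` holds and a fair path starts in every initial state, then the clauses for `E_f c` hold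
when every `q i` is the existence of a fair path, and `r i` is the decrease of the distance to
the `i`-th fairness condition. -/
lemma clausesEf_sat {V : Vars S} {D : Program V} {J : List (Fml S V)} {c : Fml S V}
    {hlen : 0 < J.length} {q r : Fin J.length → ℕ}
    {I I₀ : Interp M} (hJ : D.Enumerates J) (hD : AgreeOn D.preds I I₀)
    (hc : AgreeOn c.preds I I₀)
    (hq : ∀ i s, I ⟨q i, V⟩ s ↔ D.FairPathFrom I₀ s)
    (hr : ∀ i s s', I ⟨r i, V.sum V⟩ (Val.sum s s') ↔
      D.distance (J.get i) I₀ s' < D.distance (J.get i) I₀ s)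
    (hsat : ∀ s, D.init.Sat I₀ s → c.Sat I₀ s ∧ D.FairPathFrom I₀ s) :
    ∀ κ ∈ clausesEf D J c hlen q r, κ.Sat I := by
  have hinit : ∀ s, D.init.Sat I s ↔ D.init.Sat I₀ s :=
    D.init.sat_congr (hD.mono (Set.subset_union_left.trans Set.subset_union_left))
  have hnext : ∀ s s', D.next.Sat I (Val.sum s s') ↔ D.Step I₀ s s' := fun s s' =>
    D.next.sat_congr (hD.mono (Set.subset_union_right.trans Set.subset_union_left)) _
  have hcs := c.sat_congr hc
  rintro κ (rfl | ⟨i, rfl | rfl | rfl⟩)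
  · rw [Clause.sat_plain]
    simpa only [Fml.Sat, sat_unary, hinit, hcs, hq] using hsat
  · intro s hs
    have hi : J.get i ∈ D.fair := (hJ.2 _).1 (List.get_mem J i)
    simp only [Fml.Sat, Fml.sat_cur, Fml.sat_nxt, sat_unary, sat_binary, hnext, hq, hr,
      Program.sat_fair_congr hD hi] at hs ⊢
    obtain ⟨s', hstep, hs', h⟩ := Program.exists_step_of_fairPathFrom hi hs
    exact ⟨s', hstep, h.imp (fun h => ⟨h, hs'⟩) (fun h => ⟨h, hs'⟩)⟩
  · refine DisjunctivelyWellFounded.of_no_chain fun f hf => ?_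
    simp only [hr] at hf
    exact (wellFounded_iff_isEmpty_descending_chain.1 (wellFounded_lt (α := ℕ))).false
      ⟨fun n => D.distance (J.get i) I₀ (f n), hf⟩
  · rw [Clause.sat_plain]
    simp only [Fml.Sat, Fml.sat_on₂, sat_binary, hr]
    exact fun a h => h.2.trans h.1

lemma clausesEfEmpty_sat {V : Vars S} {D : Program V} {c : Fml S V} {q : ℕ}
    {I I₀ : Interp M} (hD : AgreeOn D.preds I I₀) (hc : AgreeOn c.preds I I₀)
    (hq : ∀ s, I ⟨q, V⟩ s ↔ D.FairPathFrom I₀ s)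
    (hsat : ∀ s, D.init.Sat I₀ s → c.Sat I₀ s ∧ D.FairPathFrom I₀ s) :
    ∀ κ ∈ clausesEfEmpty D c q, κ.Sat I := by
  have hinit : ∀ s, D.init.Sat I s ↔ D.init.Sat I₀ s :=
    D.init.sat_congr (hD.mono (Set.subset_union_left.trans Set.subset_union_left))
  have hnext : ∀ s s', D.next.Sat I (Val.sum s s') ↔ D.Step I₀ s s' := fun s s' =>
    D.next.sat_congr (hD.mono (Set.subset_union_right.trans Set.subset_union_left)) _
  have hcs := c.sat_congr hc
  rintro κ (rfl | rfl)
  · rw [Clause.sat_plain]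
    simpa only [Fml.Sat, sat_unary, hinit, hcs, hq] using hsat
  · intro s hs
    simp only [Fml.Sat, Fml.sat_nxt, sat_unary, hnext, hq] at hs ⊢
    obtain ⟨p, hp, hf, rfl⟩ := hs
    exact ⟨p 1, hp 0, _, hp.shift 1, hf.shift 1, rfl⟩

/-! ### Elimination of temporal operators -/

/-- The state of the program before the Boolean variable was added. -/
def Val.old {V : Vars S} (s : Val M V.withBool) : Val M V := fun t x => s t (CTLStar.old t x)

lemma Fml.sat_rename_old (I : Interp M) {V : Vars S} (c : Fml S V) (s : Val M V.withBool) :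
    (c.rename old).Sat I s ↔ c.Sat I s.old :=
  c.sat_rename I _ _

lemma Program.isPath_extend {V : Vars S} (D : Program V) (ini : Fml S V.withBool)
    (R : Fml S (V.withBool.sum V.withBool)) (F : Set (Fml S V.withBool)) (I : Interp M)
    (p : ℕ → Val M V.withBool) :
    (D.extend ini R F).IsPath I p ↔
      D.IsPath I (fun i => (p i).old) ∧ ∀ i, R.Sat I (Val.sum (p i) (p (i + 1))) := by
  have h : ∀ s s' : Val M V.withBool,
      (fun t x => Val.sum s s' t (Sum.map (old t) (old t) x)) = Val.sum s.old s'.old := by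
    intro s s'
    funext t x
    cases x <;> rfl
  simp only [Program.IsPath, Program.extend, Fml.Sat, Fml.sat_rename, h, forall_and]

lemma Program.isFair_extend {V : Vars S} (D : Program V) (ini : Fml S V.withBool)
    (R : Fml S (V.withBool.sum V.withBool)) (F : Set (Fml S V.withBool)) (I : Interp M)
    (p : ℕ → Val M V.withBool) :
    (D.extend ini R F).IsFair I p ↔
      D.IsFair I (fun i => (p i).old) ∧ ∀ c ∈ F, ∀ n, ∃ m, n ≤ m ∧ c.Sat I (p m) := by
  simp only [Program.IsFair, Program.extend, Set.mem_union, or_imp, forall_and,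
    Set.forall_mem_image, Fml.sat_rename_old]

lemma Program.preds_extend_subset {V : Vars S} (D : Program V) {P : Set (PredSym S)}
    {ini : Fml S V.withBool} {R : Fml S (V.withBool.sum V.withBool)} {F : Set (Fml S V.withBool)}
    (hD : D.preds ⊆ P) (hi : ini.preds ⊆ P) (hR : R.preds ⊆ P) (hF : ∀ c ∈ F, c.preds ⊆ P) :
    (D.extend ini R F).preds ⊆ P := by
  rintro p ((h | h | h) | ⟨c, ⟨d, hd, rfl⟩ | hc, hp⟩)
  · exact hi h
  · exact hD (Or.inl (Or.inr (by rwa [Fml.preds_rename] at h)))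
  · exact hR h
  · exact hD (Or.inr ⟨d, hd, by rwa [Fml.preds_rename] at hp⟩)
  · exact hF c hc hp

lemma PF.quantifierFree_of_assertion {V : Vars S} (a : PF V) :
    ∀ c, a.assertion = some c → a.QuantifierFree := by
  induction a using PF.path_induction with
  | state a => exact fun c hc => Option.isSome_iff_exists.mpr ⟨c, hc⟩
  | and a b iha ihb =>
    simp only [PF.assertion, Option.bind_eq_some_iff, Option.map_eq_some_iff]
    rintro _ ⟨x, hx, y, hy, rfl⟩
    exact ⟨iha x hx, ihb y hy⟩
  | or a b iha ihb =>
    simp only [PF.assertion, Option.bind_eq_some_iff, Option.map_eq_some_iff]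
    rintro _ ⟨x, hx, y, hy, rfl⟩
    exact ⟨iha x hx, ihb y hy⟩
  | X a => rintro _ ⟨⟩
  | G a => rintro _ ⟨⟩
  | U a b => rintro _ ⟨⟩

namespace Tester

variable {V : Vars S} {θ : PF V} {R : Fml S (V.withBool.sum V.withBool)}
  {F : Set (Fml S V.withBool)}

lemma quantifierFree (h : Tester θ R F) : θ.QuantifierFree := by
  cases h with
  | X a c hc => exact a.quantifierFree_of_assertion c hc
  | G a c hc => exact a.quantifierFree_of_assertion c hc
  | U a b c d hc hd =>
    exact ⟨a.quantifierFree_of_assertion c hc, b.quantifierFree_of_assertion d hd⟩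

lemma preds_subset (h : Tester θ R F) : R.preds ⊆ θ.preds ∧ ∀ c ∈ F, c.preds ⊆ θ.preds := by
  have e : (newVar : Fml S V.withBool).preds = ∅ := rfl
  cases h with
  | X a c hc =>
    simp [Fml.iff, Fml.preds, Fml.cur, Fml.nxt, Fml.preds_rename, PF.preds, e,
      a.preds_assertion c hc]
  | G a c hc =>
    simp [Fml.iff, Fml.preds, Fml.cur, Fml.nxt, Fml.preds_rename, PF.preds, e,
      a.preds_assertion c hc]
  | U a b c d hc hd =>
    simp [Fml.iff, Fml.preds, Fml.cur, Fml.nxt, Fml.preds_rename, PF.preds, e,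
      a.preds_assertion c hc, b.preds_assertion d hd]

/-- Along a path that satisfies the constraint and the fairness conditions, the new variable has
the truth value of `θ`. The fairness condition excludes the solution of the fixpoint equation
`x = (c ∧ x')` that is false forever although `c` is true, and that of
`x = (c₂ ∨ (c₁ ∧ x'))` that is true forever although `c₂` is false. -/
lemma newVar_sat_iff (h : Tester θ R F) (D : Program V) (I : Interp M)
    (p : ℕ → Val M V.withBool) (hR : ∀ i, R.Sat I (Val.sum (p i) (p (i + 1))))
    (hF : ∀ c ∈ F, ∀ n, ∃ m, n ≤ m ∧ c.Sat I (p m)) (n : ℕ) :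
    (newVar : Fml S V.withBool).Sat I (p n) ↔ θ.Sat D I (fun i => (p (i + n)).old) := by
  cases h with
  | X a c hc =>
    simp only [Fml.sat_iff, Fml.sat_cur, Fml.sat_nxt, Fml.sat_rename_old] at hR
    simp only [PF.Sat, a.sat_assertion D I c hc, hR, zero_add, add_comm 1]
  | G a c hc =>
    simp only [Fml.sat_iff, Fml.sat_cur, Fml.sat_nxt, Fml.sat_rename_old, Fml.sat_and] at hR
    simp only [Set.mem_singleton_iff, forall_eq, Fml.sat_or, Fml.sat_neg,
      Fml.sat_rename_old] at hF
    simp only [PF.Sat, a.sat_assertion D I c hc, zero_add]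
    constructor
    · intro hn k
      suffices h : (newVar : Fml S V.withBool).Sat I (p (k + n)) from ((hR _).1 h).1
      induction k with
      | zero => rwa [zero_add]
      | succ k ih => rw [add_right_comm]; exact ((hR _).1 ih).2
    · intro hall
      by_contra hn
      have hk : ∀ k, ¬ (newVar : Fml S V.withBool).Sat I (p (k + n)) := by
        intro k
        induction k with
        | zero => rwa [zero_add]
        | succ k ih => rw [add_right_comm]; exact fun h => ih ((hR _).2 ⟨hall k, h⟩)
      obtain ⟨m, hm, h⟩ := hF n
      rw [← Nat.sub_add_cancel hm] at h
      exact h.elim (hk _) (fun h => h (hall _))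
  | U a b c d hc hd =>
    simp only [Fml.sat_iff, Fml.sat_cur, Fml.sat_nxt, Fml.sat_rename_old, Fml.sat_and,
      Fml.sat_or] at hR
    simp only [Set.mem_singleton_iff, forall_eq, Fml.sat_or, Fml.sat_neg,
      Fml.sat_rename_old] at hF
    simp only [PF.Sat, a.sat_assertion D I c hc, b.sat_assertion D I d hd, zero_add]
    constructor
    · intro hn
      by_contra hno
      have hk : ∀ k, (newVar : Fml S V.withBool).Sat I (p (k + n)) ∧
          ∀ j < k, c.Sat I (p (j + n)).old := by
        intro k
        induction k with
        | zero => exact ⟨by rwa [zero_add], fun j hj => absurd hj (Nat.not_lt_zero j)⟩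
        | succ k ih =>
          rcases (hR _).1 ih.1 with h | h
          · exact absurd ⟨k, h, ih.2⟩ hno
          · refine ⟨by rw [add_right_comm]; exact h.2, fun j hj => ?_⟩
            rcases Nat.lt_succ_iff_lt_or_eq.mp hj with hj | rfl
            exacts [ih.2 j hj, h.1]
      obtain ⟨m, hm, h⟩ := hF n
      rw [← Nat.sub_add_cancel hm] at h
      exact h.elim (fun h => h (hk _).1) (fun h => hno ⟨_, h, (hk _).2⟩)
    · rintro ⟨k, hk, hj⟩
      induction k generalizing n with
      | zero => exact (hR n).2 (Or.inl (by rwa [zero_add] at hk))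
      | succ k ih =>
        refine (hR n).2 (Or.inr ⟨by simpa only [zero_add] using hj 0 (Nat.succ_pos k), ?_⟩)
        refine ih (n + 1) (by rwa [← add_assoc, add_right_comm]) fun j hjk => ?_
        rw [← add_assoc, add_right_comm]
        exact hj (j + 1) (by omega)

end Tester

/-- The path `p` together with the truth values of `θ` along it. -/
noncomputable def PF.annotate {V : Vars S} (θ : PF V) (D : Program V) (I : Interp M)
    (p : ℕ → Val M V) (n : ℕ) : Val M V.withBool :=
  open Classical in
  Val.sum (p n) (Val.single (t := Ty.bool) (decide (θ.Sat D I (fun i => p (i + n))) : Bool))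

lemma PF.newVar_sat_annotate {V : Vars S} (θ : PF V) (D : Program V) (I : Interp M)
    (p : ℕ → Val M V) (n : ℕ) :
    (newVar : Fml S V.withBool).Sat I (θ.annotate D I p n) ↔ θ.Sat D I (fun i => p (i + n)) := by
  classical
  exact decide_eq_true_iff

lemma PF.old_annotate {V : Vars S} (θ : PF V) (D : Program V) (I : Interp M)
    (p : ℕ → Val M V) (n : ℕ) : (θ.annotate D I p n).old = p n := rfl

lemma PF.annotate_congr {V : Vars S} {θ : PF V} {D : Program V} {I I' : Interp M}
    (hD : AgreeOn D.preds I I') (hθ : AgreeOn θ.preds I I') (p : ℕ → Val M V) (n : ℕ) :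
    θ.annotate D I p n = θ.annotate D I' p n := by
  rw [PF.annotate, propext (θ.sat_congr hD hθ _), PF.annotate]

/-- The truth values of `θ` satisfy the constraint and the fairness conditions. -/
lemma Tester.annotate {V : Vars S} {θ : PF V} {R : Fml S (V.withBool.sum V.withBool)}
    {F : Set (Fml S V.withBool)} (h : Tester θ R F) (D : Program V) (I : Interp M)
    (p : ℕ → Val M V) :
    (∀ i, R.Sat I (Val.sum (θ.annotate D I p i) (θ.annotate D I p (i + 1)))) ∧
    ∀ c ∈ F, ∀ n, ∃ m, n ≤ m ∧ c.Sat I (θ.annotate D I p m) := by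
  cases h with
  | X a c hc =>
    simp only [Fml.sat_iff, Fml.sat_cur, Fml.sat_nxt, Fml.sat_rename_old, PF.newVar_sat_annotate,
      PF.old_annotate, PF.Sat, a.sat_assertion D I c hc, zero_add, add_comm 1]
    exact ⟨fun _ => trivial, fun _ h => h.elim⟩
  | G a c hc =>
    simp only [Fml.sat_iff, Fml.sat_cur, Fml.sat_nxt, Fml.sat_rename_old, PF.newVar_sat_annotate,
      PF.old_annotate, PF.Sat, a.sat_assertion D I c hc, zero_add, Fml.sat_and,
      Set.mem_singleton_iff, forall_eq, Fml.sat_or, Fml.sat_neg]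
    refine ⟨fun i => ⟨fun h => ⟨by simpa only [zero_add] using h 0, fun k => ?_⟩,
      fun h k => ?_⟩, fun n => ?_⟩
    · simpa only [add_assoc, add_comm 1] using h (k + 1)
    · cases k with
      | zero => simpa only [zero_add] using h.1
      | succ k => simpa only [add_assoc, add_comm 1] using h.2 k
    · by_cases hn : ∀ k, c.Sat I (p (k + n))
      · exact ⟨n, le_rfl, Or.inl hn⟩
      · obtain ⟨k, hk⟩ := not_forall.mp hn
        exact ⟨k + n, Nat.le_add_left n k, Or.inr hk⟩
  | U a b c d hc hd =>
    simp only [Fml.sat_iff, Fml.sat_cur, Fml.sat_nxt, Fml.sat_rename_old, PF.newVar_sat_annotate,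
      PF.old_annotate, PF.Sat, a.sat_assertion D I c hc, b.sat_assertion D I d hd, zero_add,
      Fml.sat_and, Set.mem_singleton_iff, forall_eq, Fml.sat_or, Fml.sat_neg]
    refine ⟨fun i => ⟨?_, ?_⟩, fun n => ?_⟩
    · rintro ⟨k, hk, hj⟩
      cases k with
      | zero => exact Or.inl (by rwa [zero_add] at hk)
      | succ k =>
        refine Or.inr ⟨by simpa only [zero_add] using hj 0 (Nat.succ_pos k), k,
          by rwa [← add_assoc, add_right_comm], fun j hjk => ?_⟩
        rw [← add_assoc, add_right_comm]
        exact hj (j + 1) (by omega)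
    · rintro (h | ⟨h, k, hk, hj⟩)
      · exact ⟨0, by rwa [zero_add], fun j hj => absurd hj (Nat.not_lt_zero j)⟩
      · refine ⟨k + 1, by rwa [add_right_comm], fun j hjk => ?_⟩
        cases j with
        | zero => rwa [zero_add]
        | succ j => rw [add_right_comm]; exact hj j (by omega)
    · by_cases hn : ∃ k, d.Sat I (p (k + n)) ∧ ∀ j < k, c.Sat I (p (j + n))
      · obtain ⟨k, hk, -⟩ := hn
        exact ⟨k + n, Nat.le_add_left n k, Or.inr hk⟩
      · exact ⟨n, le_rfl, Or.inl hn⟩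

/-- If the new variable has the truth value of `θ` along `p`, then eliminating `θ` does not change
the truth of `π`. -/
lemma PF.sat_elim {V : Vars S} (D : Program V) (D' : Program V.withBool) (I : Interp M)
    {π θ : PF V} (hπ : π.QuantifierFree) (hθ : θ.QuantifierFree) (p : ℕ → Val M V.withBool)
    (h : ∀ n, (newVar : Fml S V.withBool).Sat I (p n) ↔
      θ.Sat D I (fun i => (p (i + n)).old)) :
    (π.elim θ).Sat D' I p ↔ π.Sat D I (fun i => (p i).old) := by
  rw [PF.elim, PF.sat_replace]
  · exact π.sat_rename D D' I old hπ p
  · intro n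
    rw [θ.sat_rename D D' I old hθ]
    simp only [PF.Sat, SF.Sat, zero_add]
    exact h n

lemma PF.preds_elim_subset {V : Vars S} (π θ : PF V) : (π.elim θ).preds ⊆ π.preds := by
  refine (PF.preds_replace_subset _ _ _).trans (Set.union_subset ?_ ?_)
  · rw [PF.preds_rename]
  · exact Set.empty_subset _

/-! ### The translation system -/

lemma Program.preds_setInit_subset {V : Vars S} (D : Program V) (ini : Fml S V) :
    ({ D with init := ini } : Program V).preds ⊆ ini.preds ∪ D.preds := by
  rintro p ((h | h) | h)
  exacts [Or.inl h, Or.inr (Or.inl (Or.inr h)), Or.inr (Or.inr h)]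

lemma Program.preds_dropFair_subset {V : Vars S} (D : Program V) :
    ({ D with fair := ∅ } : Program V).preds ⊆ D.preds := by
  rintro p (h | ⟨c, hc, -⟩)
  exacts [Or.inl h, hc.elim]

lemma SF.sat_setInit {V : Vars S} (D : Program V) (ini : Fml S V) (I : Interp M) {φ : SF V}
    (h : φ.IsBasic) (s : Val M V) : φ.Sat { D with init := ini } I s ↔ φ.Sat D I s := by
  obtain ⟨Q, π, rfl, hπ⟩ := h
  cases Q <;> simp only [SF.Sat, Program.IsPath, Program.IsFair, π.sat_program _ D I hπ]

/-- Relative completeness in a form that is preserved when further symbols are interpreted: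
the clauses hold under every interpretation that agrees with `I` on the symbols of the verification
problem and the new symbols. -/
theorem Trans.exists_interp {V : Vars S} {D : Program V} {φ : SF V} {N : Set (PredSym S)}
    {C : Set (Clause S)} (h : Trans D φ N C) : ∀ I₀ : Interp M, D.Satisfies I₀ φ →
    ∃ I : Interp M, (∀ p, p ∉ N → I p = I₀ p) ∧
      ∀ I' : Interp M, AgreeOn (N ∪ (D.preds ∪ φ.preds)) I' I → ∀ κ ∈ C, κ.Sat I' := by
  induction h with
  | @basicSub V D φ₂ φ₁ aux N₁ N₂ C₁ C₂ hbasic hocc hN haux hfresh _ _ ih₁ ih₂ =>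
    intro I₀ hsat
    obtain ⟨I₁, hI₁, haux₁⟩ := exists_interp_update_single (M := M) ⟨aux, V⟩
      (fun s => φ₁.Sat D I₀ s) I₀
    have hocc' := SF.preds_subset_of_occurs φ₂ hocc
    have h₀₁ : AgreeOn (D.preds ∪ φ₂.preds) I₁ I₀ := agreeOn_of_disjoint hI₁
      (hfresh.mono_left (Set.singleton_subset_iff.2 (Set.mem_insert _ _)))
    have hD₀₁ : AgreeOn D.preds I₁ I₀ := h₀₁.mono Set.subset_union_left
    have haux_iff : ∀ s, I₁ ⟨aux, V⟩ s ↔ φ₁.Sat D I₁ s := by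
      intro s
      rw [haux₁, φ₁.sat_congr hD₀₁ (h₀₁.mono (hocc'.trans Set.subset_union_right))]
    obtain ⟨I₂, hI₂, hC₁⟩ := ih₁ I₁ fun s hs =>
      (SF.sat_setInit D _ I₁ hbasic s).2 ((haux_iff s).1 hs)
    have hsub₁ : ({ D with init := unary aux } : Program V).preds ∪ φ₁.preds ⊆
        {⟨aux, V⟩} ∪ (D.preds ∪ φ₂.preds) := by
      refine Set.union_subset ((D.preds_setInit_subset _).trans ?_)
        ((hocc'.trans Set.subset_union_right).trans Set.subset_union_right)
      exact Set.union_subset_union_right _ Set.subset_union_left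
    have hsub₂ : D.preds ∪ (SF.replace φ₁ (.asrt (unary aux)) φ₂).preds ⊆
        {⟨aux, V⟩} ∪ (D.preds ∪ φ₂.preds) := by
      refine Set.union_subset (Set.subset_union_left.trans Set.subset_union_right)
        ((SF.preds_replace_subset _ _ _).trans ?_)
      exact Set.union_subset (Set.subset_union_right.trans Set.subset_union_right)
        Set.subset_union_left
    have hdisj : ∀ N' ⊆ N₁ ∪ N₂, Disjoint N' ({⟨aux, V⟩} ∪ (D.preds ∪ φ₂.preds)) := by
      intro N' hN'
      refine Set.disjoint_union_right.2 ⟨Set.disjoint_singleton_right.2 fun h => haux (hN' h), ?_⟩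
      exact hfresh.mono_left (hN'.trans (Set.subset_insert _ _))
    have hsat₂ : D.Satisfies I₂ (SF.replace φ₁ (.asrt (unary aux)) φ₂) := by
      rw [Program.satisfies_congr
        (agreeOn_of_disjoint hI₂ ((hdisj _ Set.subset_union_left).mono_right hsub₂))]
      intro s hs
      have hγ : ∀ s, (SF.asrt (unary aux)).Sat D I₁ s ↔ φ₁.Sat D I₁ s := haux_iff
      exact (SF.sat_replace hγ φ₂ s).2 ((Program.satisfies_congr h₀₁).2 hsat s hs)
    obtain ⟨I₃, hI₃, hC₂⟩ := ih₂ I₂ hsat₂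
    refine ⟨I₃, fun p hp => ?_, fun I' hI' κ hκ => ?_⟩
    · have hp' : p ≠ ⟨aux, V⟩ ∧ p ∉ N₁ ∧ p ∉ N₂ := by
        simpa only [Set.mem_insert_iff, Set.mem_union, not_or] using hp
      rw [hI₃ p hp'.2.2, hI₂ p hp'.2.1, hI₁ p hp'.1]
    · have hI'' : AgreeOn ((N₁ ∪ N₂) ∪ ({⟨aux, V⟩} ∪ (D.preds ∪ φ₂.preds))) I' I₃ := by
        refine hI'.mono ?_
        rw [Set.insert_eq, ← Set.union_assoc, Set.union_comm (N₁ ∪ N₂)]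
      rcases hκ with hκ | hκ
      · refine hC₁ I' ?_ κ hκ
        -- The clauses for `φ₁` do not mention the symbols in `N₂`.
        have h₂₃ : AgreeOn (N₁ ∪ ({⟨aux, V⟩} ∪ (D.preds ∪ φ₂.preds))) I₃ I₂ :=
          agreeOn_of_disjoint hI₃
            (Set.disjoint_union_right.2 ⟨hN.symm, hdisj _ Set.subset_union_right⟩)
        exact ((hI''.mono (Set.union_subset_union_left _ Set.subset_union_left)).trans h₂₃).mono
          (Set.union_subset_union_right _ hsub₁)
      · exact hC₂ I' (hI''.mono (Set.union_subset_union Set.subset_union_right hsub₂)) κ hκ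
  | @unfairA V D π N C hπ _ _ ih =>
    intro I₀ hsat
    obtain ⟨I, hI, hC⟩ := ih I₀ fun s hs p hp _ h0 =>
      (π.sat_program _ D I₀ hπ p).2 (hsat s hs p hp h0)
    refine ⟨I, hI, fun I' hI' => hC I' (hI'.mono ?_)⟩
    exact Set.union_subset_union_right _
      (Set.union_subset_union_left _ D.preds_dropFair_subset)
  | @unfairE V D π N C hπ _ _ ih =>
    intro I₀ hsat
    obtain ⟨I, hI, hC⟩ := ih I₀ fun s hs => by
      obtain ⟨p, hp, h0, h⟩ := hsat s hs
      exact ⟨p, hp, fun _ hc => hc.elim, h0, (π.sat_program _ D I₀ hπ p).2 h⟩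
    refine ⟨I, hI, fun I' hI' => hC I' (hI'.mono ?_)⟩
    exact Set.union_subset_union_right _
      (Set.union_subset_union_left _ D.preds_dropFair_subset)
  | @temporalAf V D π θ R F N C hπ hocc hθ _ _ ih =>
    intro I₀ hsat
    obtain ⟨I, hI, hC⟩ := ih I₀ fun s hs p hp hf h0 => by
      rw [Program.isPath_extend] at hp
      rw [Program.isFair_extend] at hf
      rw [PF.sat_elim D _ I₀ hπ hθ.quantifierFree p (hθ.newVar_sat_iff D I₀ p hp.2 hf.2)]
      refine hsat s.old ((Fml.sat_rename_old I₀ _ s).1 hs) _ hp.1 hf.1 ?_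
      rw [h0]
    refine ⟨I, hI, fun I' hI' => hC I' (hI'.mono ?_)⟩
    have hθπ : θ.preds ⊆ D.preds ∪ π.preds :=
      (PF.preds_subset_of_occurs π hocc).trans Set.subset_union_right
    refine Set.union_subset_union_right _ (Set.union_subset ?_
      ((π.preds_elim_subset θ).trans Set.subset_union_right))
    refine D.preds_extend_subset Set.subset_union_left ?_ (hθ.preds_subset.1.trans hθπ)
      (fun c hc => (hθ.preds_subset.2 c hc).trans hθπ)
    rw [Fml.preds_rename]
    exact (Set.subset_union_left.trans Set.subset_union_left).trans Set.subset_union_left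
  | @temporalEf V D π θ R F aux N C hπ hocc hθ haux hfresh _ ih =>
    intro I₀ hsat
    -- The new variable is guessed to be the truth value of `θ` on a fair path satisfying `π`.
    obtain ⟨I₁, hI₁, haux₁⟩ := exists_interp_update_single (M := M) ⟨aux, V.withBool⟩
      (fun s => ∃ p, D.IsPath I₀ p ∧ D.IsFair I₀ p ∧ π.Sat D I₀ p ∧ θ.annotate D I₀ p 0 = s) I₀
    have hθπ : θ.preds ⊆ D.preds ∪ π.preds :=
      (PF.preds_subset_of_occurs π hocc).trans Set.subset_union_right
    have h₀₁ : AgreeOn (D.preds ∪ π.preds) I₁ I₀ := agreeOn_of_disjoint hI₁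
      (hfresh.mono_left (Set.singleton_subset_iff.2 (Set.mem_insert _ _)))
    have hD₀₁ : AgreeOn D.preds I₁ I₀ := h₀₁.mono Set.subset_union_left
    obtain ⟨I, hI, hC⟩ := ih I₁ fun s hs => by
      change I₁ ⟨aux, V.withBool⟩ s at hs
      rw [haux₁] at hs
      obtain ⟨p, hp, hf, hpπ, rfl⟩ := hs
      rw [← D.isPath_congr hD₀₁] at hp
      rw [← D.isFair_congr hD₀₁] at hf
      rw [← π.sat_congr hD₀₁ (h₀₁.mono Set.subset_union_right)] at hpπ
      rw [← PF.annotate_congr hD₀₁ (h₀₁.mono hθπ)]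
      have hann := hθ.annotate D I₁ p
      refine ⟨θ.annotate D I₁ p, (D.isPath_extend _ _ _ _ _).2 ⟨hp, hann.1⟩,
        (D.isFair_extend _ _ _ _ _).2 ⟨hf, hann.2⟩, rfl, ?_⟩
      exact (PF.sat_elim D _ I₁ hπ hθ.quantifierFree _
        (fun n => θ.newVar_sat_annotate D I₁ p n)).2 hpπ
    refine ⟨I, fun p hp => ?_, fun I' hI' κ hκ => ?_⟩
    · rw [Set.mem_insert_iff, not_or] at hp
      rw [hI p hp.2, hI₁ p hp.1]
    · rcases hκ with rfl | hκ
      · have hI₀ : AgreeOn D.init.preds I' I₀ := by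
          have hsub : D.init.preds ⊆ D.preds ∪ π.preds :=
            (Set.subset_union_left.trans Set.subset_union_left).trans Set.subset_union_left
          have hN : Disjoint N D.init.preds :=
            hfresh.mono (Set.subset_insert _ _) hsub
          exact ((hI'.mono (hsub.trans Set.subset_union_right)).trans
            (agreeOn_of_disjoint hI hN)).trans (h₀₁.mono hsub)
        intro s hs
        obtain ⟨p, hp, hf, rfl, hpπ⟩ := hsat s ((D.init.sat_congr hI₀ s).1 hs)
        refine ⟨fun t x => θ.annotate D I₀ p 0 t (Sum.inr x), ?_⟩
        change I' ⟨aux, V.withBool⟩ _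
        rw [hI' _ (Or.inl (Set.mem_insert _ _)), hI _ haux, haux₁]
        exact ⟨p, hp, hf, hpπ, (Val.sum_inl_inr _).symm⟩
      · refine hC I' (hI'.mono ?_) κ hκ
        have hle : D.preds ∪ π.preds ⊆ insert ⟨aux, V.withBool⟩ N ∪ (D.preds ∪ π.preds) :=
          Set.subset_union_right
        refine Set.union_subset ((Set.subset_insert _ _).trans Set.subset_union_left)
          (Set.union_subset (D.preds_extend_subset (Set.subset_union_left.trans hle) ?_
            ((hθ.preds_subset.1.trans hθπ).trans hle)
            (fun c hc => ((hθ.preds_subset.2 c hc).trans hθπ).trans hle))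
          (((π.preds_elim_subset θ).trans Set.subset_union_right).trans hle))
        exact Set.singleton_subset_iff.2 (Or.inl (Set.mem_insert _ _))
  | @baseAf V D π c J p r t hJ hc hpr hpt hrt hfresh =>
    intro I₀ hsat
    obtain ⟨I₁, hI₁, hp⟩ := exists_interp_update_single (M := M) ⟨p, V⟩ (D.BadReach c I₀) I₀
    obtain ⟨I₂, hI₂, hr⟩ := exists_interp_update_single (M := M) ⟨r, V.sum V⟩
      (fun s => D.BadReach c I₀ (fun t x => s t (Sum.inl x)) ∧
        D.Round I₀ (fun t x => s t (Sum.inl x)) (fun t x => s t (Sum.inr x))) I₁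
    obtain ⟨I₃, hI₃, ht⟩ := exists_interp_update_single (M := M) ⟨t, V.sum V⟩
      (fun s => Relation.TransGen (D.Step I₀) (fun t x => s t (Sum.inl x))
        (fun t x => s t (Sum.inr x))) I₂
    have hp' : I₃ ⟨p, V⟩ = D.BadReach c I₀ := by
      rw [hI₃ _ (fun h => hpt (congrArg PredSym.name h)),
        hI₂ _ (fun h => hpr (congrArg PredSym.name h)), hp]
    have hr' := (hI₃ ⟨r, V.sum V⟩ (fun h => hrt (congrArg PredSym.name h))).trans hr
    have hoff : ∀ q, q ∉ ({⟨p, V⟩, ⟨r, V.sum V⟩, ⟨t, V.sum V⟩} : Set (PredSym S)) →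
        I₃ q = I₀ q := by
      intro q hq
      simp only [Set.mem_insert_iff, Set.mem_singleton_iff, not_or] at hq
      rw [hI₃ q hq.2.2, hI₂ q hq.2.1, hI₁ q hq.1]
    have hagree := agreeOn_of_disjoint hoff hfresh
    refine ⟨I₃, hoff, fun I' hI' => ?_⟩
    have hI₀ := (hI'.mono Set.subset_union_right).trans hagree
    refine clausesAf_sat (I₀ := I₀) hJ (hI₀.mono Set.subset_union_left) ?_ ?_ ?_ ?_ ?_
    · rw [π.preds_assertion c hc]
      exact hI₀.mono Set.subset_union_right
    · intro s
      rw [hI' _ (Or.inl (by simp)), hp']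
    · intro s s'
      rw [hI' _ (Or.inl (by simp)), hr']
      rfl
    · intro s s'
      rw [hI' _ (Or.inl (by simp)), ht]
      rfl
    · rintro s hs hcs ⟨q, hq, hf, rfl⟩
      exact hcs ((π.sat_assertion D I₀ c hc q).1 (hsat _ hs q hq hf rfl))
  | @baseEf V D π c J hJ hlen q r hc hqr hfresh =>
    intro I₀ hsat
    let sym : Fin J.length ⊕ Fin J.length → PredSym S :=
      Sum.elim (fun i => ⟨q i, V⟩) (fun i => ⟨r i, V.sum V⟩)
    have hsym : Function.Injective sym := by
      have hname : ∀ x, (sym x).name = Sum.elim q r x := by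
        rintro (i | i) <;> rfl
      intro x y hxy
      exact hqr (by rw [← hname, ← hname, hxy])
    let val : (x : Fin J.length ⊕ Fin J.length) → Val M (sym x).arity → Prop := fun x =>
      match x with
      | .inl _ => fun s : Val M V => D.FairPathFrom I₀ s
      | .inr i => fun s : Val M (V.sum V) =>
        D.distance (J.get i) I₀ (fun t x => s t (Sum.inr x)) <
          D.distance (J.get i) I₀ (fun t x => s t (Sum.inl x))
    obtain ⟨I, hI, hval⟩ := exists_interp_update sym hsym val I₀
    have hoff : ∀ p, p ∉ {P | ∃ i, P = ⟨q i, V⟩ ∨ P = ⟨r i, V.sum V⟩} → I p = I₀ p := by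
      refine fun p hp => hI p ?_
      rintro ⟨i | i, rfl⟩
      exacts [hp ⟨i, Or.inl rfl⟩, hp ⟨i, Or.inr rfl⟩]
    have hagree := agreeOn_of_disjoint hoff hfresh
    refine ⟨I, hoff, fun I' hI' => ?_⟩
    have hI₀ := (hI'.mono Set.subset_union_right).trans hagree
    refine clausesEf_sat (I₀ := I₀) hJ (hI₀.mono Set.subset_union_left) ?_ ?_ ?_ ?_
    · rw [π.preds_assertion c hc]
      exact hI₀.mono Set.subset_union_right
    · intro i s
      rw [hI' _ (Or.inl ⟨i, Or.inl rfl⟩)]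
      exact (congrFun (hval (.inl i)) s).to_iff
    · intro i s s'
      rw [hI' _ (Or.inl ⟨i, Or.inr rfl⟩)]
      exact (congrFun (hval (.inr i)) (Val.sum s s')).to_iff
    · intro s hs
      obtain ⟨p, hp, hf, rfl, h⟩ := hsat s hs
      exact ⟨(π.sat_assertion D I₀ c hc p).1 h, p, hp, hf, rfl⟩
  | @baseEfEmpty V D π c hJ q hc hfresh =>
    intro I₀ hsat
    obtain ⟨I, hoff, hq⟩ := exists_interp_update_single (M := M) ⟨q, V⟩ (D.FairPathFrom I₀) I₀
    have hagree := agreeOn_of_disjoint hoff hfresh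
    refine ⟨I, hoff, fun I' hI' => ?_⟩
    have hI₀ := (hI'.mono Set.subset_union_right).trans hagree
    refine clausesEfEmpty_sat (I₀ := I₀) (hI₀.mono Set.subset_union_left) ?_ ?_ ?_
    · rw [π.preds_assertion c hc]
      exact hI₀.mono Set.subset_union_right
    · intro s
      rw [hI' _ (Or.inl rfl), hq]
    · intro s hs
      obtain ⟨p, hp, hf, rfl, h⟩ := hsat s hs
      exact ⟨(π.sat_assertion D I₀ c hc p).1 h, p, hp, hf, rfl⟩
  | @assertion V D φ c hc =>
    intro I₀ hsat
    refine ⟨I₀, fun _ _ => rfl, fun I' hI' κ hκ => ?_⟩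
    obtain rfl := hκ
    rw [Clause.sat_plain]
    intro s hs
    rw [← φ.sat_assertion D I' c hc]
    exact (Program.satisfies_congr (hI'.mono Set.subset_union_right)).2 hsat s hs

end CTLStar

theorem theorem2 {S : CTLStar.Signature} {M : CTLStar.Struc S} {V : CTLStar.Vars S}
    (D : CTLStar.Program V) (φ : CTLStar.SF V)
    (N : Set (CTLStar.PredSym S)) (C : Set (CTLStar.Clause S))
    (hC : CTLStar.Trans D φ N C)
    (I₀ : CTLStar.Interp M) (hD : D.Satisfies I₀ φ) :
    ∃ I : CTLStar.Interp M, (∀ p, p ∉ N → I p = I₀ p) ∧ ∀ κ ∈ C, κ.Sat I := by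
  obtain ⟨I, hI, hsat⟩ := hC.exists_interp I₀ hD
  exact ⟨I, hI, hsat I fun _ _ => rfl⟩
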